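/- Let $\Bbbk$ be a field of characteristic $0$. Let $(P,\cdot,[-,-],\Delta,\delta)$ be a finite-dimensional Poisson bialgebra: $(P,\cdot,[-,-])$ is a (not necessarily unital) Poisson algebra, $(P,\Delta,\delta)$ is a Poisson coalgebra ($\Delta$ cocommutative and coassociative, $\delta$ a Lie cobracket, $(\mathrm{id}\otimes\Delta)\delta=(\delta\otimes\mathrm{id})\Delta+(\tau\otimes\mathrm{id})(\mathrm{id}\otimes\delta)\Delta$), and with $\mathfrak u(p)q=pq$, $\mathrm{ad}(p)q=[p,q]$, for all $p,q\in P$, $$\Delta(pq)=(\mathfrak u(q)\otimes\mathrm{id})\Delta(p)+(\mathrm{id}\otimes\mathfrak u(p))\Delta(q),$$ $$\delta([p,q])=(\mathrm{ad}(p)\otimes\mathrm{id}+\mathrm{id}\otimes\mathrm{ad}(p))\delta(q)-(\mathrm{ad}(q)\otimes\mathrm{id}+\mathrm{id}\otimes\mathrm{ad}(q))\delta(p),$$ $$\Delta([p,q])=(\mathrm{ad}(p)\otimes\mathrm{id}+\mathrm{id}\otimes\mathrm{ad}(p))\Delta(q)+(\mathfrak u(q)\otimes\mathrm{id}-\mathrm{id}\otimes\mathfrak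 u(q))\delta(p),$$ $$\delta(pq)=(\mathfrak u(p)\otimes\mathrm{id})\delta(q)+(\mathfrak u(q)\otimes\mathrm{id})\delta(p)+(\mathrm{id}\otimes\mathrm{ad}(p))\Delta(q)+(\mathrm{id}\otimes\mathrm{ad}(q))\Delta(p).$$ Let $(B=\bigoplus_{i\in\mathbb Z}B_i,\circ_B,\omega)$ be a quadratic $\mathbb Z$-graded perm algebra: each $B_i$ is finite-dimensional, $B_i\circ_B B_j\subseteq B_{i+j}$, $a\circ_B(b\circ_B c)=(a\circ_B b)\circ_B c=(b\circ_B a)\circ_B c$, and $\omega$ is a skew-symmetric nondegenerate bilinear form with $\omega(a\circ_B b,c)=\omega(a,b\circ_B c-c\circ_B b)$ such that for some $m\in\mathbb Z$, $\omega(B_i,B_j)=0$ whenever $i+j+m\ne0$. For a $\mathbb Z$-graded space $A=\bigoplus A_i$ put $A\hat\otimes A=\prod_{i,j}A_i\otimes A_j$, $A\hat\otimes A\hat\otimes A=\prod_{i,j,l}A_i\otimes A_j\otimes A_l$, and let $\hat\tau$ be the twist. Then there is a unique linear map $\nu_\omega:B\to B\hat\otimes B$ with $\hat\omega(\nu_\omega(a),b\otimes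 c)=-\omega(a,b\circ_B c)$ for all $a,b,c\in B$, where $\hat\omega(\sum x\otimes x',\,b\otimes c)=\sum\omega(x,b)\,\omega(x',c)$. On $A=P\otimes B$, graded by $A_i=P\otimes B_i$, define $$(p\otimes b)\circ(p'\otimes b')=pp'\otimes(b\circ_B b'),\qquad (p\otimes b)\ast(p'\otimes b')=[p,p']\otimes(b\circ_B b'),$$ $$\nu(p\otimes b)=\Delta(p)\bullet\nu_\omega(b),\qquad \vartheta(p\otimes b)=\delta(p)\bullet\nu_\omega(b),\qquad (p\otimes p')\bullet\sum b\otimes b'=\sum(p\otimes b)\otimes(p'\otimes b').$$ Then $(A,\circ,\ast,\nu,\vartheta)$ is a completed dual pre-Poisson (DPP) bialgebra, that is: (1) All $A_i$ are finite-dimensional, $A_i\circ A_j,\ A_i\ast A_j\subseteq A_{i+j}$, and $(A,\circ,\ast)$ is a DPP algebra: $\circ$ is perm, $\ast$ is left Leibniz ($a\ast(b\ast c)=(a\ast b)\ast c+b\ast(a\ast c)$), $(a\circ b)\ast c=a\circ(b\ast c)+b\circ(a\ast c)$, and $(a\ast b)\circ c=a\ast(b\circ c)-b\circ(a\ast c)=-(b\ast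 a)\circ c$. (2) $(A,\nu,\vartheta)$ is a completed DPP coalgebra: the following composites $A\to A\hat\otimes A\hat\otimes A$ are well defined (each component is a finite sum), and $$(\nu\hat\otimes\mathrm{id})\nu=(\mathrm{id}\hat\otimes\nu)\nu=(\hat\tau\hat\otimes\mathrm{id})(\nu\hat\otimes\mathrm{id})\nu,\qquad (\mathrm{id}\hat\otimes\vartheta)\vartheta=(\vartheta\hat\otimes\mathrm{id})\vartheta+(\hat\tau\hat\otimes\mathrm{id})(\mathrm{id}\hat\otimes\vartheta)\vartheta,$$ $$(\mathrm{id}\hat\otimes\nu)\vartheta=(\vartheta\hat\otimes\mathrm{id})\nu+(\hat\tau\hat\otimes\mathrm{id})(\mathrm{id}\hat\otimes\vartheta)\nu,\qquad (\nu\hat\otimes\mathrm{id})\vartheta=(\mathrm{id}\hat\otimes\vartheta)\nu+(\hat\tau\hat\otimes\mathrm{id})(\mathrm{id}\hat\otimes\vartheta)\nu,$$ $$(\vartheta\hat\otimes\mathrm{id})\nu=-(\hat\tau\hat\otimes\mathrm{id})(\vartheta\hat\otimes\mathrm{id})\nu.$$ (3) Write $l(a)x=a\circ x$, $r(a)x=x\circ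 a$, $L(a)x=a\ast x$, $R(a)x=x\ast a$, $\nu^-=\nu-\hat\tau\nu$, $\vartheta^+=\vartheta+\hat\tau\vartheta$. For all $a,b\in A$, $(A,\circ,\nu)$ satisfies the completed perm bialgebra conditions $$(r(a)\hat\otimes\mathrm{id})\nu(b)=\hat\tau\big((r(b)\hat\otimes\mathrm{id})\nu(a)\big),$$ $$\nu(a\circ b)=((l-r)(a)\hat\otimes\mathrm{id})\nu(b)+(\mathrm{id}\hat\otimes r(b))\nu(a)=(\mathrm{id}\hat\otimes l(a))\nu(b)+((l-r)(b)\hat\otimes\mathrm{id})\nu^-(a),$$ $(A,\ast,\vartheta)$ satisfies the completed Leibniz bialgebra conditions $$\hat\tau\big((R(b)\hat\otimes\mathrm{id})\vartheta(a)\big)=(R(a)\hat\otimes\mathrm{id})\vartheta(b),$$ $$\vartheta(a\ast b)=(\mathrm{id}\hat\otimes R(b)-(L+R)(b)\hat\otimes\mathrm{id})\vartheta^+(a)+(\mathrm{id}\hat\otimes L(a)+L(a)\hat\otimes\mathrm{id})\vartheta(b),$$ and the following compatibility conditions hold: $$\nu(a\ast b)=(\mathrm{id}\hat\otimes L(a)+L(a)\hat\otimes\mathrm{id})\nu(b)+((l-r)(b)\hat\otimes\mathrm{id}-\mathrm{id}\hat\otimes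 r(b))\vartheta^+(a),$$ $$\vartheta(a\circ b)=(\mathrm{id}\hat\otimes l(a))\vartheta(b)+(\mathrm{id}\hat\otimes r(b))\vartheta(a)-((L+R)(a)\hat\otimes\mathrm{id})\nu(b)-((L+R)(b)\hat\otimes\mathrm{id})\nu^-(a),$$ $$(\mathrm{id}\hat\otimes R(a))\hat\tau\nu(b)=-(r(b)\hat\otimes\mathrm{id})\vartheta(a),$$ $$\nu(a\ast b)=(\mathrm{id}\hat\otimes l(a)-l(a)\hat\otimes\mathrm{id})\vartheta(b)+(\mathrm{id}\hat\otimes R(b)-(L+R)(b)\hat\otimes\mathrm{id})\nu^-(a),$$ $$\vartheta^+(a\circ b)=(\mathrm{id}\hat\otimes l(a))\vartheta^+(b)+(\mathrm{id}\hat\otimes l(b))\vartheta^+(a)-(L(a)\hat\otimes\mathrm{id})\nu^-(b)-(L(b)\hat\otimes\mathrm{id})\nu^-(a),$$ $$\vartheta(a\circ b)=(l(a)\hat\otimes\mathrm{id})\vartheta(b)-(\mathrm{id}\hat\otimes R(b))\nu^-(a)+(\mathrm{id}\hat\otimes L(a))\nu(b)+((l-r)(b)\hat\otimes\mathrm{id})\vartheta^+(a),$$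 $$\nu(a\ast b+b\ast a)=(\mathrm{id}\hat\otimes(L+R)(a))\nu(b)+((L+R)(a)\hat\otimes\mathrm{id})\hat\tau\nu(b)+(\mathrm{id}\hat\otimes(l-r)(b))\vartheta(a)+((l-r)(b)\hat\otimes\mathrm{id})\hat\tau\vartheta(a).$$ -/

import Mathlib

open scoped TensorProduct

namespace CompletedDPP

noncomputable section

/-! ## Algebras given by bilinear products -/

section Algebras

variable {k A : Type*} [Field k] [AddCommGroup A] [Module k A]

/-- Perm algebra: `a (b c) = (a b) c = (b a) c`. -/
structure IsPermAlgebra (m : A →ₗ[k] A →ₗ[k] A) : Prop where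
  assoc : ∀ a b c, m a (m b c) = m (m a b) c
  perm : ∀ a b c, m (m a b) c = m (m b a) c

/-- (Left) Leibniz algebra: `a * (b * c) = (a * b) * c + b * (a * c)`. -/
structure IsLeibnizAlgebra (s : A →ₗ[k] A →ₗ[k] A) : Prop where
  leibniz : ∀ a b c, s a (s b c) = s (s a b) c + s b (s a c)

/-- Dual pre-Poisson (DPP) algebra with perm product `m` and Leibniz product `s`. -/
structure IsDPPAlgebra (m s : A →ₗ[k] A →ₗ[k] A) : Prop where
  perm : IsPermAlgebra m
  leibniz : IsLeibnizAlgebra s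
  compat₁ : ∀ a b c, s (m a b) c = m a (s b c) + m b (s a c)
  compat₂ : ∀ a b c, m (s a b) c = s a (m b c) - m b (s a c)
  compat₃ : ∀ a b c, m (s a b) c = -m (s b a) c

/-- Poisson algebra: commutative associative product `m`, Lie bracket `br`, Leibniz rule. -/
structure IsPoissonAlgebra (m br : A →ₗ[k] A →ₗ[k] A) : Prop where
  comm : ∀ a b, m a b = m b a
  assoc : ∀ a b c, m a (m b c) = m (m a b) c
  antisymm : ∀ a b, br a b = -br b a
  jacobi : ∀ a b c, br a (br b c) + br b (br c a) + br c (br a b) = 0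
  leibniz : ∀ a b c, br a (m b c) = m (br a b) c + m b (br a c)

/-- Poisson coalgebra: cocommutative coassociative `Δ`, Lie coalgebra `δ`, and the co-Leibniz
rule. Threefold tensor products are bracketed as `A ⊗ (A ⊗ A)`; `leftComm` is `τ ⊗ id`. -/
structure IsPoissonCoalgebra (Δ δ : A →ₗ[k] A ⊗[k] A) : Prop where
  cocomm : ∀ a, TensorProduct.comm k A A (Δ a) = Δ a
  coassoc : ∀ a, TensorProduct.assoc k A A A (Δ.rTensor A (Δ a)) = Δ.lTensor A (Δ a)
  coantisymm : ∀ a, TensorProduct.comm k A A (δ a) = -δ a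
  cojacobi : ∀ a, δ.lTensor A (δ a) - TensorProduct.leftComm k A A A (δ.lTensor A (δ a))
    = TensorProduct.assoc k A A A (δ.rTensor A (δ a))
  coleibniz : ∀ a, Δ.lTensor A (δ a) = TensorProduct.assoc k A A A (δ.rTensor A (Δ a))
    + TensorProduct.leftComm k A A A (δ.lTensor A (Δ a))

/-- Poisson bialgebra. Here `m a` is the multiplication operator and `br a` is the adjoint
operator, `rTensor` is `· ⊗ id` and `lTensor` is `id ⊗ ·`. -/
structure IsPoissonBialgebra (m br : A →ₗ[k] A →ₗ[k] A) (Δ δ : A →ₗ[k] A ⊗[k] A) : Prop where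
  alg : IsPoissonAlgebra m br
  coalg : IsPoissonCoalgebra Δ δ
  /-- infinitesimal bialgebra -/
  infinitesimal : ∀ a b, Δ (m a b) = (m b).rTensor A (Δ a) + (m a).lTensor A (Δ b)
  /-- Lie bialgebra -/
  lie : ∀ a b, δ (br a b) = ((br a).rTensor A (δ b) + (br a).lTensor A (δ b))
    - ((br b).rTensor A (δ a) + (br b).lTensor A (δ a))
  compat₁ : ∀ a b, Δ (br a b) = ((br a).rTensor A (Δ b) + (br a).lTensor A (Δ b))
    + ((m b).rTensor A (δ a) - (m b).lTensor A (δ a))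
  compat₂ : ∀ a b, δ (m a b) = (m a).rTensor A (δ b) + (m b).rTensor A (δ a)
    + (br a).lTensor A (Δ b) + (br b).lTensor A (Δ a)

end Algebras

/-! ## Graded algebras and completed tensor products -/

section Graded

variable {k A : Type*} [Field k] [AddCommGroup A] [Module k A] (𝒜 : ℤ → Submodule k A)

/-- `𝒜 i · 𝒜 j ⊆ 𝒜 (i + j)`. -/
def IsGradedMul (m : A →ₗ[k] A →ₗ[k] A) : Prop :=
  ∀ i j : ℤ, ∀ a ∈ 𝒜 i, ∀ b ∈ 𝒜 j, m a b ∈ 𝒜 (i + j)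

/-- The completed tensor product `A ⊗̂ A = ∏_{i,j} A_i ⊗ A_j`. -/
abbrev CTensor : Type _ := ∀ i j : ℤ, 𝒜 i ⊗[k] 𝒜 j

/-- The completed triple tensor product `A ⊗̂ A ⊗̂ A = ∏_{i,j,l} A_i ⊗ (A_j ⊗ A_l)`. -/
abbrev CTensor₃ : Type _ := ∀ i j l : ℤ, 𝒜 i ⊗[k] (𝒜 j ⊗[k] 𝒜 l)

/-- The completed twist `τ̂`. -/
def flip (X : CTensor 𝒜) : CTensor 𝒜 := fun i j => TensorProduct.comm k (𝒜 j) (𝒜 i) (X j i)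

/-- `τ̂ ⊗̂ id` on the completed triple tensor product. -/
def flip₁₂ (X : CTensor₃ 𝒜) : CTensor₃ 𝒜 := fun i j l =>
  TensorProduct.leftComm k (𝒜 j) (𝒜 i) (𝒜 l) (X j i l)

variable {𝒜} in
/-- The `(i, j)` component of a completed comultiplication. -/
def comp (ν : A →ₗ[k] CTensor 𝒜) (i j : ℤ) : A →ₗ[k] 𝒜 i ⊗[k] 𝒜 j :=
  LinearMap.proj j ∘ₗ LinearMap.proj i ∘ₗ ν

variable {𝒜} in
/-- The contribution of `X_{i,l}` to the `(p, q, l)` component of `(ν ⊗̂ id)(X)`. -/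
def leftTerm (ν : A →ₗ[k] CTensor 𝒜) (X : CTensor 𝒜) (p q l i : ℤ) :
    𝒜 p ⊗[k] (𝒜 q ⊗[k] 𝒜 l) :=
  TensorProduct.assoc k (𝒜 p) (𝒜 q) (𝒜 l)
    ((comp ν p q ∘ₗ (𝒜 i).subtype).rTensor (𝒜 l) (X i l))

variable {𝒜} in
/-- The contribution of `X_{p,j}` to the `(p, q, l)` component of `(id ⊗̂ ν)(X)`. -/
def rightTerm (ν : A →ₗ[k] CTensor 𝒜) (X : CTensor 𝒜) (p q l j : ℤ) :
    𝒜 p ⊗[k] (𝒜 q ⊗[k] 𝒜 l) :=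
  (comp ν q l ∘ₗ (𝒜 j).subtype).lTensor (𝒜 p) (X p j)

variable {𝒜} in
/-- Every component of `(ν ⊗̂ id)(X)` and of `(id ⊗̂ ν)(X)` is a finite sum, so that both
elements of the completed triple tensor product are well defined. -/
def ExtendsTo (ν : A →ₗ[k] CTensor 𝒜) (X : CTensor 𝒜) : Prop :=
  ∀ p q l : ℤ, (Function.support (leftTerm ν X p q l)).Finite ∧
    (Function.support (rightTerm ν X p q l)).Finite

variable {𝒜} in
/-- `(ν ⊗̂ id)(X)`; meaningful under `ExtendsTo ν X`. -/
def cLeft (ν : A →ₗ[k] CTensor 𝒜) (X : CTensor 𝒜) : CTensor₃ 𝒜 := fun p q l =>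
  ∑ᶠ i : ℤ, leftTerm ν X p q l i

variable {𝒜} in
/-- `(id ⊗̂ ν)(X)`; meaningful under `ExtendsTo ν X`. -/
def cRight (ν : A →ₗ[k] CTensor 𝒜) (X : CTensor 𝒜) : CTensor₃ 𝒜 := fun p q l =>
  ∑ᶠ j : ℤ, rightTerm ν X p q l j

/-- Completed perm coalgebra. -/
structure IsCompletedPermCoalgebra (ν : A →ₗ[k] CTensor 𝒜) : Prop where
  extends_to : ∀ a, ExtendsTo ν (ν a)
  coassoc : ∀ a, cLeft ν (ν a) = cRight ν (ν a)
  coperm : ∀ a, cRight ν (ν a) = flip₁₂ 𝒜 (cLeft ν (ν a))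

/-- Completed (left) Leibniz coalgebra, the completed dual of a left Leibniz algebra. -/
structure IsCompletedLeibnizCoalgebra (ϑ : A →ₗ[k] CTensor 𝒜) : Prop where
  extends_to : ∀ a, ExtendsTo ϑ (ϑ a)
  coleibniz : ∀ a, cRight ϑ (ϑ a) = cLeft ϑ (ϑ a) + flip₁₂ 𝒜 (cRight ϑ (ϑ a))

/-- Completed DPP coalgebra. -/
structure IsCompletedDPPCoalgebra (ν ϑ : A →ₗ[k] CTensor 𝒜) : Prop where
  perm : IsCompletedPermCoalgebra 𝒜 ν
  leibniz : IsCompletedLeibnizCoalgebra 𝒜 ϑ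
  extends_to₁ : ∀ a, ExtendsTo ν (ϑ a)
  extends_to₂ : ∀ a, ExtendsTo ϑ (ν a)
  compat₁ : ∀ a, cRight ν (ϑ a) = cLeft ϑ (ν a) + flip₁₂ 𝒜 (cRight ϑ (ν a))
  compat₂ : ∀ a, cLeft ν (ϑ a) = cRight ϑ (ν a) + flip₁₂ 𝒜 (cRight ϑ (ν a))
  compat₃ : ∀ a, cLeft ϑ (ν a) = -flip₁₂ 𝒜 (cLeft ϑ (ν a))

variable [DirectSum.Decomposition 𝒜]

/-- The projection `A → A_i`. -/
def proj (i : ℤ) : A →ₗ[k] 𝒜 i :=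
  DirectSum.component k ℤ (fun i => 𝒜 i) i ∘ₗ (DirectSum.decomposeLinearEquiv 𝒜).toLinearMap

/-- The matrix entry `A_i → A_j` of a linear map. -/
def block (f : A →ₗ[k] A) (i j : ℤ) : 𝒜 i →ₗ[k] 𝒜 j := proj 𝒜 j ∘ₗ f ∘ₗ (𝒜 i).subtype

/-- `(f ⊗̂ g)(X)`. It is applied only to sums of left and right multiplication operators of a graded
algebra and to the identity; the sums are then finite by `finite_block_left`,
`finite_block_right` and `finite_block_id`. -/
def cMap (f g : A →ₗ[k] A) (X : CTensor 𝒜) : CTensor 𝒜 := fun p q =>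
  ∑ᶠ ij : ℤ × ℤ, TensorProduct.map (block 𝒜 f ij.1 p) (block 𝒜 g ij.2 q) (X ij.1 ij.2)

theorem proj_of_mem {i j : ℤ} {x : A} (hx : x ∈ 𝒜 i) (hij : i ≠ j) : proj 𝒜 j x = 0 := by
  apply Subtype.ext
  exact DirectSum.decompose_of_mem_ne 𝒜 hx hij

theorem finite_block_id (j : ℤ) : {i | block 𝒜 LinearMap.id i j ≠ 0}.Finite := by
  refine (Set.finite_singleton j).subset fun i hi => ?_
  by_contra hne
  exact hi (LinearMap.ext fun x => proj_of_mem 𝒜 x.2 hne)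

theorem finite_block_aux (f : A →ₗ[k] A →ₗ[k] A)
    (hf : ∀ i j : ℤ, ∀ a ∈ 𝒜 i, ∀ b ∈ 𝒜 j, f a b ∈ 𝒜 (i + j)) (a : A) (j : ℤ) :
    {i | block 𝒜 (f a) i j ≠ 0}.Finite := by
  induction a using DirectSum.Decomposition.inductionOn 𝒜 with
  | zero => simp [block]
  | @homogeneous d a =>
    refine (Set.finite_singleton (j - d)).subset fun i hi => ?_
    by_contra hne
    refine hi (LinearMap.ext fun x => proj_of_mem 𝒜 (hf d i a a.2 x x.2) fun h => hne ?_)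
    simp only [Set.mem_singleton_iff]
    omega
  | add a b ha hb =>
    refine (ha.union hb).subset fun i hi => ?_
    by_contra hne
    simp only [Set.mem_union, Set.mem_ofPred_eq, not_or, not_not] at hne
    refine hi ?_
    have : block 𝒜 (f (a + b)) i j = block 𝒜 (f a) i j + block 𝒜 (f b) i j := by
      ext x; simp [block]
    rw [this, hne.1, hne.2, add_zero]

theorem finite_block_left {m : A →ₗ[k] A →ₗ[k] A} (hm : IsGradedMul 𝒜 m) (a : A) (j : ℤ) :
    {i | block 𝒜 (m a) i j ≠ 0}.Finite :=
  finite_block_aux 𝒜 m hm a j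

theorem finite_block_right {m : A →ₗ[k] A →ₗ[k] A} (hm : IsGradedMul 𝒜 m) (a : A) (j : ℤ) :
    {i | block 𝒜 (m.flip a) i j ≠ 0}.Finite :=
  finite_block_aux 𝒜 m.flip
    (fun i j a ha b hb => by rw [add_comm]; exact hm j i b hb a ha) a j

/-- `ℤ`-graded perm algebra, with finite-dimensional components. -/
structure IsGradedPermAlgebra (m : A →ₗ[k] A →ₗ[k] A) : Prop where
  perm : IsPermAlgebra m
  finite : ∀ i, Module.Finite k (𝒜 i)
  graded : IsGradedMul 𝒜 m

/-- `ℤ`-graded Leibniz algebra, with finite-dimensional components. -/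
structure IsGradedLeibnizAlgebra (s : A →ₗ[k] A →ₗ[k] A) : Prop where
  leibniz : IsLeibnizAlgebra s
  finite : ∀ i, Module.Finite k (𝒜 i)
  graded : IsGradedMul 𝒜 s

/-- `ℤ`-graded DPP algebra, with finite-dimensional components. -/
structure IsGradedDPPAlgebra (m s : A →ₗ[k] A →ₗ[k] A) : Prop where
  dpp : IsDPPAlgebra m s
  finite : ∀ i, Module.Finite k (𝒜 i)
  graded_perm : IsGradedMul 𝒜 m
  graded_leibniz : IsGradedMul 𝒜 s

/-- Quadratic `ℤ`-graded perm algebra: a skew-symmetric, invariant, nondegenerate and graded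
bilinear form on a `ℤ`-graded perm algebra. -/
structure IsQuadraticGradedPermAlgebra (m : A →ₗ[k] A →ₗ[k] A) (ω : A →ₗ[k] A →ₗ[k] k) :
    Prop where
  perm : IsGradedPermAlgebra 𝒜 m
  skew : ∀ a b, ω a b = -ω b a
  invariant : ∀ a b c, ω (m a b) c = ω a (m b c - m c b)
  nondegenerate : ∀ a, (∀ b, ω a b = 0) → a = 0
  graded : ∃ d : ℤ, ∀ i j : ℤ, i + j + d ≠ 0 → ∀ a ∈ 𝒜 i, ∀ b ∈ 𝒜 j, ω a b = 0

/-- Completed perm bialgebra. Here `m a` is left and `m.flip a` right multiplication. -/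
structure IsCompletedPermBialgebra (m : A →ₗ[k] A →ₗ[k] A) (ν : A →ₗ[k] CTensor 𝒜) :
    Prop where
  alg : IsGradedPermAlgebra 𝒜 m
  coalg : IsCompletedPermCoalgebra 𝒜 ν
  compat₁ : ∀ a b, cMap 𝒜 (m.flip a) .id (ν b) = flip 𝒜 (cMap 𝒜 (m.flip b) .id (ν a))
  compat₂ : ∀ a b, ν (m a b) = cMap 𝒜 (m a - m.flip a) .id (ν b) + cMap 𝒜 .id (m.flip b) (ν a)
  compat₃ : ∀ a b, ν (m a b) = cMap 𝒜 .id (m a) (ν b)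
    + cMap 𝒜 (m b - m.flip b) .id (ν a - flip 𝒜 (ν a))

/-- Completed Leibniz bialgebra. -/
structure IsCompletedLeibnizBialgebra (s : A →ₗ[k] A →ₗ[k] A) (ϑ : A →ₗ[k] CTensor 𝒜) :
    Prop where
  alg : IsGradedLeibnizAlgebra 𝒜 s
  coalg : IsCompletedLeibnizCoalgebra 𝒜 ϑ
  compat₁ : ∀ a b, flip 𝒜 (cMap 𝒜 (s.flip b) .id (ϑ a)) = cMap 𝒜 (s.flip a) .id (ϑ b)
  compat₂ : ∀ a b, ϑ (s a b) =
    (cMap 𝒜 .id (s.flip b) (ϑ a + flip 𝒜 (ϑ a))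
      - cMap 𝒜 (s b + s.flip b) .id (ϑ a + flip 𝒜 (ϑ a)))
    + (cMap 𝒜 .id (s a) (ϑ b) + cMap 𝒜 (s a) .id (ϑ b))

/-- Completed DPP bialgebra `(A, m, s, ν, ϑ)` with perm product `m` and Leibniz product `s`. -/
structure IsCompletedDPPBialgebra (m s : A →ₗ[k] A →ₗ[k] A) (ν ϑ : A →ₗ[k] CTensor 𝒜) :
    Prop where
  alg : IsGradedDPPAlgebra 𝒜 m s
  coalg : IsCompletedDPPCoalgebra 𝒜 ν ϑ
  perm : IsCompletedPermBialgebra 𝒜 m ν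
  leibniz : IsCompletedLeibnizBialgebra 𝒜 s ϑ
  compat₁ : ∀ a b, ν (s a b) =
    (cMap 𝒜 .id (s a) (ν b) + cMap 𝒜 (s a) .id (ν b))
    + (cMap 𝒜 (m b - m.flip b) .id (ϑ a + flip 𝒜 (ϑ a))
      - cMap 𝒜 .id (m.flip b) (ϑ a + flip 𝒜 (ϑ a)))
  compat₂ : ∀ a b, ϑ (m a b) =
    cMap 𝒜 .id (m a) (ϑ b) + cMap 𝒜 .id (m.flip b) (ϑ a)
    - cMap 𝒜 (s a + s.flip a) .id (ν b)
    - cMap 𝒜 (s b + s.flip b) .id (ν a - flip 𝒜 (ν a))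
  compat₃ : ∀ a b, cMap 𝒜 .id (s.flip a) (flip 𝒜 (ν b)) = -cMap 𝒜 (m.flip b) .id (ϑ a)
  compat₄ : ∀ a b, ν (s a b) =
    (cMap 𝒜 .id (m a) (ϑ b) - cMap 𝒜 (m a) .id (ϑ b))
    + (cMap 𝒜 .id (s.flip b) (ν a - flip 𝒜 (ν a))
      - cMap 𝒜 (s b + s.flip b) .id (ν a - flip 𝒜 (ν a)))
  compat₅ : ∀ a b, ϑ (m a b) + flip 𝒜 (ϑ (m a b)) =
    cMap 𝒜 .id (m a) (ϑ b + flip 𝒜 (ϑ b)) + cMap 𝒜 .id (m b) (ϑ a + flip 𝒜 (ϑ a))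
    - cMap 𝒜 (s a) .id (ν b - flip 𝒜 (ν b)) - cMap 𝒜 (s b) .id (ν a - flip 𝒜 (ν a))
  compat₆ : ∀ a b, ϑ (m a b) =
    cMap 𝒜 (m a) .id (ϑ b) - cMap 𝒜 .id (s.flip b) (ν a - flip 𝒜 (ν a))
    + cMap 𝒜 .id (s a) (ν b) + cMap 𝒜 (m b - m.flip b) .id (ϑ a + flip 𝒜 (ϑ a))
  compat₇ : ∀ a b, ν (s a b + s b a) =
    cMap 𝒜 .id (s a + s.flip a) (ν b) + cMap 𝒜 (s a + s.flip a) .id (flip 𝒜 (ν b))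
    + cMap 𝒜 .id (m b - m.flip b) (ϑ a) + cMap 𝒜 (m b - m.flip b) .id (flip 𝒜 (ϑ a))

end Graded

/-! ## The coproduct defined by the form, and the induced structure on `P ⊗ B` -/

section Induced

variable {k P B : Type*} [Field k] [AddCommGroup P] [Module k P] [AddCommGroup B] [Module k B]
  (ℬ : ℤ → Submodule k B)

/-- The pairing `ω̂(X, y ⊗ z) = ∑_{i,j} ω(x_i, y) ω(x'_j, z)` for `X = ∑ x_i ⊗ x'_j` in the
completed tensor product; the sum is finite when `ω` is a graded form. -/
def hatForm (ω : B →ₗ[k] B →ₗ[k] k) (X : CTensor ℬ) (y z : B) : k :=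
  ∑ᶠ ij : ℤ × ℤ, LinearMap.mul' k k
    (TensorProduct.map (ω.flip y ∘ₗ (ℬ ij.1).subtype) (ω.flip z ∘ₗ (ℬ ij.2).subtype)
      (X ij.1 ij.2))

/-- The property defining `ν_ω`: `ω̂(ν_ω(a), b ⊗ c) = -ω(a, b ∘ c)`. -/
def IsFormCoproduct (m : B →ₗ[k] B →ₗ[k] B) (ω : B →ₗ[k] B →ₗ[k] k)
    (ν : B →ₗ[k] CTensor ℬ) : Prop :=
  ∀ a b c, hatForm ℬ ω (ν a) b c = -ω a (m b c)

variable (P) in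
/-- The grading `(P ⊗ B)_i = P ⊗ B_i` of `P ⊗ B`. -/
def tensorGrading (i : ℤ) : Submodule k (P ⊗[k] B) :=
  LinearMap.range ((ℬ i).subtype.lTensor P)

variable (P) in
/-- The canonical map from `P ⊗ B_i` onto the degree `i` part of `P ⊗ B`. -/
def toTensorGrading (i : ℤ) : P ⊗[k] ℬ i →ₗ[k] tensorGrading P ℬ i :=
  ((ℬ i).subtype.lTensor P).rangeRestrict

theorem coe_toTensorGrading_tmul (i : ℤ) (p : P) (b : ℬ i) :
    (toTensorGrading P ℬ i (p ⊗ₜ b) : P ⊗[k] B) = p ⊗ₜ (b : B) := rfl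

/-- `P ⊗ B` is the direct sum of the `P ⊗ B_i`. -/
instance tensorGradingDecomposition [DirectSum.Decomposition ℬ] :
    DirectSum.Decomposition (tensorGrading P ℬ) := by
  refine .ofLinearMap _ (DirectSum.lmap (toTensorGrading P ℬ) ∘ₗ
    (TensorProduct.directSumRight k k P fun i => ℬ i).toLinearMap ∘ₗ
    ((DirectSum.decomposeLinearEquiv ℬ).lTensor P).toLinearMap) ?_ ?_
  · simp_rw [← LinearMap.comp_assoc]
    rw [← LinearEquiv.eq_comp_toLinearMap_symm, ← LinearMap.cancel_right
      (TensorProduct.directSumRight k k P fun i => ℬ i).symm.surjective]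
    ext
    simp [coe_toTensorGrading_tmul]
  · ext i : 1
    have hs : Function.Surjective (toTensorGrading P ℬ i) := LinearMap.surjective_rangeRestrict _
    rw [← LinearMap.cancel_right hs]
    ext : 3
    simp [coe_toTensorGrading_tmul]

/-- The bilinear product `(p ⊗ b)(p' ⊗ b') = f(p, p') ⊗ m(b, b')` on `P ⊗ B`. -/
def tensorMul (f : P →ₗ[k] P →ₗ[k] P) (m : B →ₗ[k] B →ₗ[k] B) :
    P ⊗[k] B →ₗ[k] P ⊗[k] B →ₗ[k] P ⊗[k] B :=
  TensorProduct.map₂ f m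

/-- `(p ⊗ p') • (b ⊗ b') = (p ⊗ b) ⊗ (p' ⊗ b')` on the `(i, j)` component. -/
def bulletComp (i j : ℤ) : (P ⊗[k] P) ⊗[k] (ℬ i ⊗[k] ℬ j) →ₗ[k]
    tensorGrading P ℬ i ⊗[k] tensorGrading P ℬ j :=
  TensorProduct.map (toTensorGrading P ℬ i) (toTensorGrading P ℬ j) ∘ₗ
    (TensorProduct.tensorTensorTensorComm k P P (ℬ i) (ℬ j)).toLinearMap

/-- The coproduct `p ⊗ b ↦ D(p) • ν(b)` from `P ⊗ B` to `(P ⊗ B) ⊗̂ (P ⊗ B)`. -/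
def bullet (D : P →ₗ[k] P ⊗[k] P) (ν : B →ₗ[k] CTensor ℬ) :
    P ⊗[k] B →ₗ[k] CTensor (tensorGrading P ℬ) :=
  LinearMap.pi fun i => LinearMap.pi fun j =>
    bulletComp ℬ i j ∘ₗ TensorProduct.map D (comp ν i j)

end Induced

end

end CompletedDPP

/-!
The coproduct `ν_ω` exists and is unique because, in complementary degrees, the form `ω` identifies
`B_i` with the dual of `B_j` (`IsSymplecticGradedForm.toDual_bijective`): the pairing `ω̂` identifies
`B_i ⊗ B_j` with the dual of a tensor product of two homogeneous components, and `ν_ω` is dual to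
the product (`isFormCoproduct_formCoproduct`, `IsFormCoproduct.unique`). For the same reason every
identity in `B ⊗̂ B` or `B ⊗̂ B ⊗̂ B` may be tested against homogeneous elements of `B`, where it
becomes an identity in the perm algebra. With `N = ν_ω`, left multiplications being `ω`-self-adjoint
and `r(a)` having adjoint `l(a) - r(a)`, one finds

* `(l(a) ⊗̂ id) N(b) = (id ⊗̂ l(a)) N(b) = N(ab)`, `(r(a) ⊗̂ id) N(b) = 0` and
  `(id ⊗̂ r(a)) N(b) = N(ba)`;
* `τ̂ N(ab - ba) = N(ab - ba)`;
* `(N ⊗̂ id) N(b) = (id ⊗̂ N) N(b)`, and this element is fixed by `τ̂ ⊗̂ id`.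

All operations on `P ⊗ B` act on elements `X • Y`, with `X` in a tensor power of `P` and `Y` in a
completed tensor power of `B`, one factor at a time (`cMap_map_first`, `cMap_map_second`,
`cLeft_bulletₗ`, `cRight_bulletₗ`). Hence each identity of the coalgebra part becomes an
identity of iterated coproducts of the Poisson coalgebra `P`, multiplied by the single element
`(N ⊗̂ id) N(b)`. In the same way each bialgebra condition, for `a = p ⊗ b` and `a' = q ⊗ c`, becomes
a relation `∑ X_i • Y_i = 0` in which every `Y_i` is a combination of the three elements `N(bc)`,
`N(cb)` and `τ̂ N(bc)`, the fourth element `τ̂ N(cb)` being eliminated by the symmetry of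
commutators. The coefficients in `P ⊗ P` then cancel by the axioms of a Poisson bialgebra.
-/

namespace CompletedDPP

noncomputable section

/-! ### Operators acting on one leg of a completed tensor product -/

section Operators

variable {k A : Type*} [Field k] [AddCommGroup A] [Module k A] (𝒜 : ℤ → Submodule k A)

/-- A sum over pairs whose terms vanish off the fibre `j = q` is a sum over the first index. -/
theorem finsum_prod_eq_finsum_of_snd_ne {M : Type*} [AddCommMonoid M] (F : ℤ × ℤ → M) (q : ℤ)
    (h : ∀ i j, j ≠ q → F (i, j) = 0) : ∑ᶠ ij, F ij = ∑ᶠ i, F (i, q) := by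
  rw [← finsum_mem_range (f := F) (g := fun i : ℤ => (i, q)) (Prod.mk_left_injective q),
    ← finsum_mem_univ]
  refine finsum_mem_inter_support_eq' _ _ _ fun x hx => ?_
  simp only [Set.mem_univ, Set.mem_range, true_iff]
  obtain ⟨i, j⟩ := x
  refine ⟨i, ?_⟩
  by_contra hne
  exact hx (h i j fun e => hne (by rw [e]))

-- These two instances shorten instance searches, which are costly for `A = P ⊗ B`.
instance : AddCommGroup (CTensor 𝒜) := inferInstance

instance : AddCommGroup (CTensor₃ 𝒜) := inferInstance

/-- The completed twist as a linear map. -/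
def flipₗ : CTensor 𝒜 →ₗ[k] CTensor 𝒜 where
  toFun := flip 𝒜
  map_add' X Y := by ext i j; simp [flip]
  map_smul' c X := by ext i j; simp [flip]

theorem flipₗ_apply (X : CTensor 𝒜) : flipₗ 𝒜 X = flip 𝒜 X := rfl

theorem flip_flip (X : CTensor 𝒜) : flip 𝒜 (flip 𝒜 X) = X := by
  ext i j
  exact (TensorProduct.comm k (𝒜 i) (𝒜 j)).symm_apply_apply (X i j)

/-- The completed twist `τ̂ ⊗̂ id` as a linear map. -/
def flip₁₂ₗ : CTensor₃ 𝒜 →ₗ[k] CTensor₃ 𝒜 where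
  toFun := flip₁₂ 𝒜
  map_add' X Y := by ext i j l; simp [flip₁₂]
  map_smul' c X := by ext i j l; simp [flip₁₂]

variable [DirectSum.Decomposition 𝒜]

theorem proj_coe (i : ℤ) (x : 𝒜 i) : proj 𝒜 i x = x := by
  apply Subtype.ext
  exact DirectSum.decompose_of_mem_same 𝒜 x.2

theorem block_id_of_ne {i j : ℤ} (h : i ≠ j) : block 𝒜 LinearMap.id i j = 0 :=
  LinearMap.ext fun x => proj_of_mem 𝒜 x.2 h

theorem block_id_self (i : ℤ) : block 𝒜 LinearMap.id i i = LinearMap.id :=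
  LinearMap.ext fun x => proj_coe 𝒜 i x

theorem block_add (f g : A →ₗ[k] A) (i j : ℤ) :
    block 𝒜 (f + g) i j = block 𝒜 f i j + block 𝒜 g i j := by
  ext x; simp [block]

theorem block_smul (c : k) (f : A →ₗ[k] A) (i j : ℤ) :
    block 𝒜 (c • f) i j = c • block 𝒜 f i j := by
  ext x; simp [block]

/-- The operators that, for each `j`, have only finitely many nonzero blocks `A_i → A_j`. They act
on either leg of the completed tensor product. -/
def rowFinite : Submodule k (A →ₗ[k] A) where
  carrier := {f | ∀ j, {i | block 𝒜 f i j ≠ 0}.Finite}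
  zero_mem' j := by simp [block]
  add_mem' {f g} hf hg j := ((hf j).union (hg j)).subset fun i hi => by
    by_contra hne
    simp only [Set.mem_union, Set.mem_ofPred_eq, not_or, not_not] at hne
    exact hi (by rw [block_add, hne.1, hne.2, add_zero])
  smul_mem' c f hf j := (hf j).subset fun i hi h => hi (by rw [block_smul, h, smul_zero])

variable {𝒜}

theorem finite_support_rTensor_block {f : A →ₗ[k] A} (hf : f ∈ rowFinite 𝒜) (X : CTensor 𝒜)
    (p q : ℤ) :
    (Function.support fun i => (block 𝒜 f i p).rTensor (𝒜 q) (X i q)).Finite :=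
  (hf p).subset fun i hi h => hi (by simp [h])

theorem cMap_id_right (f : A →ₗ[k] A) (X : CTensor 𝒜) (p q : ℤ) :
    cMap 𝒜 f .id X p q = ∑ᶠ i, (block 𝒜 f i p).rTensor (𝒜 q) (X i q) := by
  rw [cMap, finsum_prod_eq_finsum_of_snd_ne _ q]
  · simp only [block_id_self]; rfl
  · intro i j hj
    rw [block_id_of_ne 𝒜 hj, TensorProduct.map_zero_right, LinearMap.zero_apply]

theorem flip_cMap (f g : A →ₗ[k] A) (X : CTensor 𝒜) :
    flip 𝒜 (cMap 𝒜 f g X) = cMap 𝒜 g f (flip 𝒜 X) := by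
  funext p q
  refine ((TensorProduct.comm k (𝒜 q) (𝒜 p)).toAddEquiv.map_finsum _).trans ?_
  rw [cMap, ← finsum_comp_equiv (Equiv.prodComm ℤ ℤ)]
  refine finsum_congr fun ij => ?_
  simp only [flip, Equiv.prodComm_apply, Prod.fst_swap, Prod.snd_swap]
  exact (TensorProduct.map_comm (block 𝒜 g ij.1 p) (block 𝒜 f ij.2 q) (X ij.2 ij.1)).symm

/-- The action `f ↦ f ⊗̂ id` of row-finite operators on the completed tensor product. -/
def opFirst : rowFinite 𝒜 →ₗ[k] CTensor 𝒜 →ₗ[k] CTensor 𝒜 :=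
  LinearMap.mk₂ k (fun f X => cMap 𝒜 f.1 .id X)
    (fun f g X => by
      funext p q
      simp only [Pi.add_apply, cMap_id_right]
      rw [← finsum_add_distrib (finite_support_rTensor_block f.2 X p q)
        (finite_support_rTensor_block g.2 X p q)]
      simp [block_add, LinearMap.rTensor_add])
    (fun c f X => by
      funext p q
      simp only [Pi.smul_apply, cMap_id_right]
      rw [smul_finsum' c (finite_support_rTensor_block f.2 X p q)]
      simp [block_smul, LinearMap.rTensor_smul])
    (fun f X Y => by
      funext p q
      simp only [Pi.add_apply, cMap_id_right]
      rw [← finsum_add_distrib (finite_support_rTensor_block f.2 X p q)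
        (finite_support_rTensor_block f.2 Y p q)]
      simp)
    (fun c f X => by
      funext p q
      simp only [Pi.smul_apply, cMap_id_right]
      rw [smul_finsum' c (finite_support_rTensor_block f.2 X p q)]
      simp)

theorem cMap_id_left (f : A →ₗ[k] A) (X : CTensor 𝒜) :
    cMap 𝒜 .id f X = flip 𝒜 (cMap 𝒜 f .id (flip 𝒜 X)) := by
  rw [flip_cMap, flip_flip]

variable {f g : A →ₗ[k] A} (hf : f ∈ rowFinite 𝒜) (hg : g ∈ rowFinite 𝒜)
include hf hg

theorem cMap_add_left (X : CTensor 𝒜) :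
    cMap 𝒜 (f + g) .id X = cMap 𝒜 f .id X + cMap 𝒜 g .id X :=
  LinearMap.congr_fun 
    (map_add (opFirst (𝒜 := 𝒜)) (⟨f, hf⟩ : rowFinite 𝒜) ⟨g, hg⟩) X

theorem cMap_sub_left (X : CTensor 𝒜) :
    cMap 𝒜 (f - g) .id X = cMap 𝒜 f .id X - cMap 𝒜 g .id X :=
  LinearMap.congr_fun 
    (map_sub (opFirst (𝒜 := 𝒜)) (⟨f, hf⟩ : rowFinite 𝒜) ⟨g, hg⟩) X

theorem cMap_add_right (X : CTensor 𝒜) :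
    cMap 𝒜 .id (f + g) X = cMap 𝒜 .id f X + cMap 𝒜 .id g X := by
  simp only [cMap_id_left, cMap_add_left hf hg, ← flipₗ_apply, map_add]

theorem cMap_sub_right (X : CTensor 𝒜) :
    cMap 𝒜 .id (f - g) X = cMap 𝒜 .id f X - cMap 𝒜 .id g X := by
  simp only [cMap_id_left, cMap_sub_left hf hg, ← flipₗ_apply, map_sub]

end Operators

section Actions

variable {k A : Type*} [Field k] [AddCommGroup A] [Module k A] {𝒜 : ℤ → Submodule k A}
  [DirectSum.Decomposition 𝒜] (m : A →ₗ[k] A →ₗ[k] A) (hm : ∀ a, m a ∈ rowFinite 𝒜)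

/-- The bilinear map `(a, X) ↦ (m(a, ·) ⊗̂ id)(X)`. -/
def actFirst : A →ₗ[k] CTensor 𝒜 →ₗ[k] CTensor 𝒜 :=
  opFirst ∘ₗ m.codRestrict (rowFinite 𝒜) hm

theorem actFirst_apply (a : A) (X : CTensor 𝒜) :
    actFirst m hm a X = cMap 𝒜 (m a) .id X := rfl

/-- The bilinear map `(a, X) ↦ (id ⊗̂ m(a, ·))(X)`. -/
def actSecond : A →ₗ[k] CTensor 𝒜 →ₗ[k] CTensor 𝒜 :=
  LinearMap.mk₂ k (fun a X => cMap 𝒜 .id (m a) X)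
    (fun a b X => by
      rw [map_add]
      exact cMap_add_right (hm a) (hm b) X)
    (fun c a X => by
      simp only [cMap_id_left, ← actFirst_apply m hm, ← flipₗ_apply]
      rw [← map_smul, ← LinearMap.smul_apply, ← map_smul])
    (fun a X Y => by
      simp only [cMap_id_left, ← actFirst_apply m hm, ← flipₗ_apply, map_add])
    (fun c a X => by
      simp only [cMap_id_left, ← actFirst_apply m hm, ← flipₗ_apply, map_smul])

theorem actSecond_apply (a : A) (X : CTensor 𝒜) :
    actSecond m hm a X = cMap 𝒜 .id (m a) X := rfl

variable {m}

theorem mem_rowFinite_left (hm : IsGradedMul 𝒜 m) (a : A) : m a ∈ rowFinite 𝒜 :=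
  finite_block_left 𝒜 hm a

theorem mem_rowFinite_right (hm : IsGradedMul 𝒜 m) (a : A) : m.flip a ∈ rowFinite 𝒜 :=
  finite_block_right 𝒜 hm a

end Actions

/-! ### Iterated completed coproducts -/

section Iterated

variable {k A : Type*} [Field k] [AddCommGroup A] [Module k A] {𝒜 : ℤ → Submodule k A}

/-- Each component of the completed coproduct `ν` vanishes on all but finitely many of the
homogeneous components of its source. -/
def IsRowFiniteCoproduct (ν : A →ₗ[k] CTensor 𝒜) : Prop :=
  ∀ p q : ℤ, {i | comp ν p q ∘ₗ (𝒜 i).subtype ≠ 0}.Finite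

variable {ν : A →ₗ[k] CTensor 𝒜} (hν : IsRowFiniteCoproduct ν)
include hν

theorem finite_support_leftTerm (X : CTensor 𝒜) (p q l : ℤ) :
    (Function.support (leftTerm ν X p q l)).Finite :=
  (hν p q).subset fun i hi h => hi (by simp [leftTerm, h])

theorem finite_support_rightTerm (X : CTensor 𝒜) (p q l : ℤ) :
    (Function.support (rightTerm ν X p q l)).Finite :=
  (hν q l).subset fun i hi h => hi (by simp [rightTerm, h])

theorem IsRowFiniteCoproduct.extendsTo (X : CTensor 𝒜) : ExtendsTo ν X := fun p q l =>
  ⟨finite_support_leftTerm hν X p q l, finite_support_rightTerm hν X p q l⟩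

/-- `ν ⊗̂ id` as a linear map. -/
def cLeftₗ : CTensor 𝒜 →ₗ[k] CTensor₃ 𝒜 where
  toFun := cLeft ν
  map_add' X Y := by
    funext p q l
    simp only [Pi.add_apply, cLeft]
    rw [← finsum_add_distrib (finite_support_leftTerm hν X p q l)
      (finite_support_leftTerm hν Y p q l)]
    simp [leftTerm]
  map_smul' c X := by
    funext p q l
    simp only [Pi.smul_apply, cLeft, RingHom.id_apply]
    rw [smul_finsum' c (finite_support_leftTerm hν X p q l)]
    simp [leftTerm]

/-- `id ⊗̂ ν` as a linear map. -/
def cRightₗ : CTensor 𝒜 →ₗ[k] CTensor₃ 𝒜 where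
  toFun := cRight ν
  map_add' X Y := by
    funext p q l
    simp only [Pi.add_apply, cRight]
    rw [← finsum_add_distrib (finite_support_rightTerm hν X p q l)
      (finite_support_rightTerm hν Y p q l)]
    simp [rightTerm]
  map_smul' c X := by
    funext p q l
    simp only [Pi.smul_apply, cRight, RingHom.id_apply]
    rw [smul_finsum' c (finite_support_rightTerm hν X p q l)]
    simp [rightTerm]

end Iterated

/-! ### The pairing induced by a graded bilinear form -/

section Pairing

variable {k B : Type*} [Field k] [AddCommGroup B] [Module k B] {ℬ : ℤ → Submodule k B}

/-- A bilinear form of degree `d`: `B_i` and `B_j` are orthogonal unless `i + j + d = 0`. -/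
def IsGradedForm (ℬ : ℤ → Submodule k B) (ω : B →ₗ[k] B →ₗ[k] k) (d : ℤ) : Prop :=
  ∀ i j : ℤ, i + j + d ≠ 0 → ∀ a ∈ ℬ i, ∀ b ∈ ℬ j, ω a b = 0

variable (ℬ) in
/-- The functional `x ⊗ x' ↦ ω(x, y) ω(x', z)` on `B_i ⊗ B_j`. -/
def pairAt (ω : B →ₗ[k] B →ₗ[k] k) (i j : ℤ) (y z : B) : ℬ i ⊗[k] ℬ j →ₗ[k] k :=
  LinearMap.mul' k k ∘ₗ
    TensorProduct.map (ω.flip y ∘ₗ (ℬ i).subtype) (ω.flip z ∘ₗ (ℬ j).subtype)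

variable (ℬ) in
/-- The functional `x ⊗ x' ⊗ x'' ↦ ω(x, y) ω(x', z) ω(x'', w)` on `B_p ⊗ B_q ⊗ B_l`. -/
def pairAt₃ (ω : B →ₗ[k] B →ₗ[k] k) (p q l : ℤ) (y z w : B) :
    ℬ p ⊗[k] (ℬ q ⊗[k] ℬ l) →ₗ[k] k :=
  LinearMap.mul' k k ∘ₗ
    TensorProduct.map (ω.flip y ∘ₗ (ℬ p).subtype) (pairAt ℬ ω q l z w)

theorem pairAt_tmul (ω : B →ₗ[k] B →ₗ[k] k) (i j : ℤ) (y z : B) (u : ℬ i) (v : ℬ j) :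
    pairAt ℬ ω i j y z (u ⊗ₜ v) = ω u y * ω v z := by
  simp [pairAt]

theorem pairAt₃_tmul (ω : B →ₗ[k] B →ₗ[k] k) (p q l : ℤ) (y z w : B) (u : ℬ p)
    (x : ℬ q ⊗[k] ℬ l) :
    pairAt₃ ℬ ω p q l y z w (u ⊗ₜ x) = ω u y * pairAt ℬ ω q l z w x := by
  simp [pairAt₃]

theorem pairAt₃_assoc (ω : B →ₗ[k] B →ₗ[k] k) (p q l : ℤ) (y z w : B) (x : ℬ p ⊗[k] ℬ q)
    (v : ℬ l) :
    pairAt₃ ℬ ω p q l y z w (TensorProduct.assoc k _ _ _ (x ⊗ₜ v)) =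
      pairAt ℬ ω p q y z x * ω v w := by
  induction x with
  | zero => simp
  | tmul x x' => simp [pairAt₃_tmul, pairAt_tmul, mul_assoc]
  | add x x' hx hx' => simp only [TensorProduct.add_tmul, map_add, hx, hx', add_mul]

theorem pairAt₃_leftComm (ω : B →ₗ[k] B →ₗ[k] k) (p q l : ℤ) (y z w : B)
    (x : ℬ p ⊗[k] (ℬ q ⊗[k] ℬ l)) :
    pairAt₃ ℬ ω q p l z y w (TensorProduct.leftComm k _ _ _ x) = pairAt₃ ℬ ω p q l y z w x := by
  induction x with
  | zero => simp
  | add u v hu hv => simp only [map_add, hu, hv]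
  | tmul u x =>
    induction x with
    | zero => simp
    | add x x' hx hx' => simp only [TensorProduct.tmul_add, map_add, hx, hx']
    | tmul v v' =>
      rw [TensorProduct.leftComm_tmul]
      simp only [pairAt₃_tmul, pairAt_tmul]
      ring

theorem hatForm_eq_finsum (ω : B →ₗ[k] B →ₗ[k] k) (X : CTensor ℬ) (y z : B) :
    hatForm ℬ ω X y z = ∑ᶠ ij : ℤ × ℤ, pairAt ℬ ω ij.1 ij.2 y z (X ij.1 ij.2) := rfl

theorem pairAt_comm (ω : B →ₗ[k] B →ₗ[k] k) (i j : ℤ) (y z : B) (x : ℬ i ⊗[k] ℬ j) :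
    pairAt ℬ ω j i z y (TensorProduct.comm k _ _ x) = pairAt ℬ ω i j y z x := by
  induction x with
  | zero => simp
  | tmul u v => simp [pairAt_tmul, mul_comm]
  | add u v hu hv => simp [hu, hv]

theorem hatForm_flip (ω : B →ₗ[k] B →ₗ[k] k) (X : CTensor ℬ) (y z : B) :
    hatForm ℬ ω (flip ℬ X) y z = hatForm ℬ ω X z y := by
  rw [hatForm_eq_finsum, hatForm_eq_finsum, ← finsum_comp_equiv (Equiv.prodComm ℤ ℤ)]
  exact finsum_congr fun ij => pairAt_comm ω _ _ _ _ _

variable {ω : B →ₗ[k] B →ₗ[k] k} {d : ℤ}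

theorem pairAt_eq_zero_left (hω : IsGradedForm ℬ ω d) {i i' : ℤ} (j : ℤ) {y : B} (hy : y ∈ ℬ i')
    (h : i + i' + d ≠ 0) (z : B) : pairAt ℬ ω i j y z = 0 := by
  ext u v
  simp [pairAt_tmul, hω i i' h u u.2 y hy]

theorem pairAt_eq_zero_right (hω : IsGradedForm ℬ ω d) (i : ℤ) {j j' : ℤ} (y : B) {z : B}
    (hz : z ∈ ℬ j') (h : j + j' + d ≠ 0) : pairAt ℬ ω i j y z = 0 := by
  ext u v
  simp [pairAt_tmul, hω j j' h v v.2 z hz]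

theorem hatForm_of_mem_right (hω : IsGradedForm ℬ ω d) (X : CTensor ℬ) (y : B) {z : B} {j j' : ℤ}
    (hz : z ∈ ℬ j') (h : j + j' + d = 0) :
    hatForm ℬ ω X y z = ∑ᶠ i, pairAt ℬ ω i j y z (X i j) := by
  rw [hatForm_eq_finsum, finsum_prod_eq_finsum_of_snd_ne _ j]
  intro i l hl
  rw [pairAt_eq_zero_right hω i y hz (by omega), LinearMap.zero_apply]

theorem hatForm_of_mem (hω : IsGradedForm ℬ ω d) (X : CTensor ℬ) {y z : B} {i i' j j' : ℤ}
    (hy : y ∈ ℬ i') (hz : z ∈ ℬ j') (hi : i + i' + d = 0) (hj : j + j' + d = 0) :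
    hatForm ℬ ω X y z = pairAt ℬ ω i j y z (X i j) := by
  rw [hatForm_of_mem_right hω X y hz hj, finsum_eq_single _ i]
  intro l hl
  rw [pairAt_eq_zero_left hω j hy (by omega), LinearMap.zero_apply]

theorem hatForm_zero_left (X : CTensor ℬ) (z : B) : hatForm ℬ ω X 0 z = 0 := by
  simp [hatForm_eq_finsum, pairAt]

theorem hatForm_zero_right (X : CTensor ℬ) (y : B) : hatForm ℬ ω X y 0 = 0 := by
  rw [← hatForm_flip, hatForm_zero_left]

theorem hatForm_of_mem_left (hω : IsGradedForm ℬ ω d) (X : CTensor ℬ) {y : B} (z : B) {i i' : ℤ}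
    (hy : y ∈ ℬ i') (h : i + i' + d = 0) :
    hatForm ℬ ω X y z = ∑ᶠ j, pairAt ℬ ω i j y z (X i j) := by
  rw [← hatForm_flip, hatForm_of_mem_right hω _ _ hy h]
  exact finsum_congr fun j => pairAt_comm ω _ _ _ _ _

variable [DirectSum.Decomposition ℬ]

/-- A given element is orthogonal to all but finitely many components; this makes the sum
defining `hatForm` finite. -/
theorem finite_nonorthogonal (hω : IsGradedForm ℬ ω d) (y : B) :
    {i | ω.flip y ∘ₗ (ℬ i).subtype ≠ 0}.Finite := by
  induction y using DirectSum.Decomposition.inductionOn ℬ with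
  | zero => simp
  | @homogeneous e y =>
    refine (Set.finite_singleton (-d - e)).subset fun i hi => ?_
    by_contra hne
    refine hi (LinearMap.ext fun x => hω i e (fun h => hne ?_) x x.2 y y.2)
    simp only [Set.mem_singleton_iff]
    omega
  | add y z hy hz =>
    refine (hy.union hz).subset fun i hi => ?_
    by_contra hne
    simp only [Set.mem_union, Set.mem_ofPred_eq, not_or, not_not] at hne
    refine hi ?_
    rw [map_add, LinearMap.add_comp, hne.1, hne.2, add_zero]

theorem finite_support_pairAt (hω : IsGradedForm ℬ ω d) (X : CTensor ℬ) (y z : B) :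
    (Function.support fun ij : ℤ × ℤ => pairAt ℬ ω ij.1 ij.2 y z (X ij.1 ij.2)).Finite := by
  refine ((finite_nonorthogonal hω y).prod (finite_nonorthogonal hω z)).subset fun ij hij => ?_
  refine Set.mem_prod.2 ⟨fun h => hij ?_, fun h => hij ?_⟩ <;> simp [pairAt, h]

theorem hatForm_add_left (hω : IsGradedForm ℬ ω d) (X : CTensor ℬ) (y y' z : B) :
    hatForm ℬ ω X (y + y') z = hatForm ℬ ω X y z + hatForm ℬ ω X y' z := by
  simp only [hatForm_eq_finsum]
  rw [← finsum_add_distrib (finite_support_pairAt hω X y z) (finite_support_pairAt hω X y' z)]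
  refine finsum_congr fun ij => ?_
  simp [pairAt, LinearMap.add_comp, TensorProduct.map_add_left]

theorem hatForm_add_right (hω : IsGradedForm ℬ ω d) (X : CTensor ℬ) (y z z' : B) :
    hatForm ℬ ω X y (z + z') = hatForm ℬ ω X y z + hatForm ℬ ω X y z' := by
  simp only [← hatForm_flip ω X, hatForm_add_left hω]

/-- The pairing turns an operator on the first leg into its `ω`-adjoint. -/
theorem hatForm_cMap (hω : IsGradedForm ℬ ω d) {f g : B →ₗ[k] B} (hf : f ∈ rowFinite ℬ)
    (hfg : ∀ x y, ω (f x) y = ω x (g y)) (X : CTensor ℬ) {y z : B} {i j : ℤ}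
    (hy : y ∈ ℬ i) (hz : z ∈ ℬ j) :
    hatForm ℬ ω (cMap ℬ f .id X) y z = hatForm ℬ ω X (g y) z := by
  -- only the components of degree `p` and `q` pair non-trivially with `y` and `z`
  obtain ⟨p, hp⟩ : ∃ p, p + i + d = 0 := ⟨-d - i, by ring⟩
  obtain ⟨q, hq⟩ : ∃ q, q + j + d = 0 := ⟨-d - j, by ring⟩
  rw [hatForm_of_mem hω _ hy hz hp hq, hatForm_of_mem_right hω X _ hz hq, cMap_id_right,
    map_finsum _ (finite_support_rTensor_block hf X p q)]
  refine finsum_congr fun l => ?_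
  induction X l q with
  | zero => simp
  | add u v hu hv => simp only [map_add, hu, hv]
  | tmul u v =>
    rw [LinearMap.rTensor_tmul, pairAt_tmul, pairAt_tmul, ← hfg]
    congr 1
    -- `y` is orthogonal to all components of `f u` except the one of degree `p`
    suffices h : ∀ x : B, ω (proj ℬ p x) y = ω x y from h _
    intro x
    induction x using DirectSum.Decomposition.inductionOn ℬ with
    | zero => simp
    | add x x' hx hx' => simp only [map_add, Submodule.coe_add, LinearMap.add_apply, hx, hx']
    | @homogeneous e x =>
      by_cases he : e = p
      · subst he; rw [proj_coe]
      · rw [proj_of_mem ℬ x.2 he, hω e i (by omega) x x.2 y hy]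
        simp

end Pairing

/-! ### Nondegeneracy of the induced pairings -/

section Nondegenerate

variable {k B : Type*} [Field k] [AddCommGroup B] [Module k B] (ℬ : ℤ → Submodule k B)
  [DirectSum.Decomposition ℬ] (ω : B →ₗ[k] B →ₗ[k] k)

/-- A nondegenerate skew-symmetric form of degree `d`. -/
structure IsSymplecticGradedForm (d : ℤ) : Prop where
  graded : IsGradedForm ℬ ω d
  skew : ∀ a b, ω a b = -ω b a
  nondegenerate : ∀ a, (∀ b, ω a b = 0) → a = 0

/-- The map `B_i → (B_j)^*` induced by `ω`. -/
def toDual (i j : ℤ) : ℬ i →ₗ[k] Module.Dual k (ℬ j) :=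
  (ω.compl₂ (ℬ j).subtype) ∘ₗ (ℬ i).subtype

variable {ℬ ω} {d : ℤ}

theorem IsSymplecticGradedForm.toDual_injective (hω : IsSymplecticGradedForm ℬ ω d) {i j : ℤ}
    (h : i + j + d = 0) : Function.Injective (toDual ℬ ω i j) := by
  rw [← LinearMap.ker_eq_bot, LinearMap.ker_eq_bot']
  intro x hx
  apply Subtype.ext
  refine hω.nondegenerate _ fun y => ?_
  induction y using DirectSum.Decomposition.inductionOn ℬ with
  | zero => simp
  | add y z hy hz => rw [map_add, hy, hz, add_zero]
  | @homogeneous e y =>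
    by_cases he : e = j
    · subst he
      exact LinearMap.congr_fun hx y
    · exact hω.graded i e (by omega) x x.2 y y.2

variable [∀ i, Module.Finite k (ℬ i)]

/-- In complementary degrees the form identifies `B_i` with the dual of `B_j`. -/
theorem IsSymplecticGradedForm.toDual_bijective (hω : IsSymplecticGradedForm ℬ ω d) {i j : ℤ}
    (h : i + j + d = 0) : Function.Bijective (toDual ℬ ω i j) := by
  have h₁ := LinearMap.finrank_le_finrank_of_injective (hω.toDual_injective h)
  have h₂ := LinearMap.finrank_le_finrank_of_injective
    (hω.toDual_injective (show j + i + d = 0 by omega))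
  rw [Subspace.dual_finrank_eq] at h₁ h₂
  refine ⟨hω.toDual_injective h, ?_⟩
  refine (LinearMap.injective_iff_surjective_of_finrank_eq_finrank ?_).1 (hω.toDual_injective h)
  rw [Subspace.dual_finrank_eq]
  exact le_antisymm h₁ h₂

/-- `B_i ⊗ B_j ≃ (B_{i'} ⊗ B_{j'})^*` for complementary degrees. -/
def tensorDualEquiv (hω : IsSymplecticGradedForm ℬ ω d) {i i' j j' : ℤ}
    (hi : i + i' + d = 0) (hj : j + j' + d = 0) :
    ℬ i ⊗[k] ℬ j ≃ₗ[k] Module.Dual k (ℬ i' ⊗[k] ℬ j') :=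
  TensorProduct.congr (LinearEquiv.ofBijective _ (hω.toDual_bijective hi))
    (LinearEquiv.ofBijective _ (hω.toDual_bijective hj)) ≪≫ₗ
    TensorProduct.dualDistribEquiv k (ℬ i') (ℬ j')

theorem tensorDualEquiv_apply_tmul (hω : IsSymplecticGradedForm ℬ ω d) {i i' j j' : ℤ}
    (hi : i + i' + d = 0) (hj : j + j' + d = 0) (x : ℬ i ⊗[k] ℬ j) (y : ℬ i') (z : ℬ j') :
    tensorDualEquiv hω hi hj x (y ⊗ₜ z) = pairAt ℬ ω i j y z x := by
  induction x with
  | zero => simp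
  | add u v hu hv => rw [map_add, LinearMap.add_apply, hu, hv, map_add]
  | tmul u v =>
    rw [pairAt_tmul]
    rfl

theorem IsSymplecticGradedForm.eq_zero_of_pairAt (hω : IsSymplecticGradedForm ℬ ω d)
    {i i' j j' : ℤ} (hi : i + i' + d = 0) (hj : j + j' + d = 0) {x : ℬ i ⊗[k] ℬ j}
    (h : ∀ y ∈ ℬ i', ∀ z ∈ ℬ j', pairAt ℬ ω i j y z x = 0) : x = 0 := by
  apply (tensorDualEquiv hω hi hj).injective
  rw [map_zero]
  ext y z
  exact (tensorDualEquiv_apply_tmul hω hi hj x y z).trans (h y y.2 z z.2)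

/-- An element of `B ⊗̂ B` is determined by its pairings with homogeneous elements. -/
theorem IsSymplecticGradedForm.hatForm_ext (hω : IsSymplecticGradedForm ℬ ω d) {X Y : CTensor ℬ}
    (h : ∀ i j, ∀ y ∈ ℬ i, ∀ z ∈ ℬ j, hatForm ℬ ω X y z = hatForm ℬ ω Y y z) : X = Y := by
  funext p q
  rw [← sub_eq_zero]
  have hp : p + (-d - p) + d = 0 := by ring
  have hq : q + (-d - q) + d = 0 := by ring
  refine hω.eq_zero_of_pairAt hp hq fun y hy z hz => ?_
  rw [map_sub, ← hatForm_of_mem hω.graded X hy hz hp hq,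
    ← hatForm_of_mem hω.graded Y hy hz hp hq, h _ _ y hy z hz, sub_self]

/-- `B_p ⊗ B_q ⊗ B_l ≃ (B_{p'} ⊗ B_{q'} ⊗ B_{l'})^*` for complementary degrees. -/
def tensorDualEquiv₃ (hω : IsSymplecticGradedForm ℬ ω d) {p p' q q' l l' : ℤ}
    (hp : p + p' + d = 0) (hq : q + q' + d = 0) (hl : l + l' + d = 0) :
    ℬ p ⊗[k] (ℬ q ⊗[k] ℬ l) ≃ₗ[k] Module.Dual k (ℬ p' ⊗[k] (ℬ q' ⊗[k] ℬ l')) :=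
  TensorProduct.congr (LinearEquiv.ofBijective _ (hω.toDual_bijective hp))
    (tensorDualEquiv hω hq hl) ≪≫ₗ
    TensorProduct.dualDistribEquiv k (ℬ p') (ℬ q' ⊗[k] ℬ l')

theorem tensorDualEquiv₃_apply_tmul (hω : IsSymplecticGradedForm ℬ ω d) {p p' q q' l l' : ℤ}
    (hp : p + p' + d = 0) (hq : q + q' + d = 0) (hl : l + l' + d = 0)
    (x : ℬ p ⊗[k] (ℬ q ⊗[k] ℬ l)) (y : ℬ p') (z : ℬ q') (w : ℬ l') :
    tensorDualEquiv₃ hω hp hq hl x (y ⊗ₜ (z ⊗ₜ w)) = pairAt₃ ℬ ω p q l y z w x := by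
  induction x with
  | zero => simp
  | add u v hu hv => rw [map_add, LinearMap.add_apply, hu, hv, map_add]
  | tmul u v =>
    rw [pairAt₃_tmul, ← tensorDualEquiv_apply_tmul hω hq hl]
    rfl

/-- An element of `B ⊗̂ B ⊗̂ B` is determined by its pairings with homogeneous elements. -/
theorem IsSymplecticGradedForm.ext₃ (hω : IsSymplecticGradedForm ℬ ω d) {X Y : CTensor₃ ℬ}
    (h : ∀ p p' q q' l l' : ℤ, p + p' + d = 0 → q + q' + d = 0 → l + l' + d = 0 →
      ∀ y ∈ ℬ p', ∀ z ∈ ℬ q', ∀ w ∈ ℬ l',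
        pairAt₃ ℬ ω p q l y z w (X p q l) = pairAt₃ ℬ ω p q l y z w (Y p q l)) : X = Y := by
  funext p q l
  have hp : p + (-d - p) + d = 0 := by ring
  have hq : q + (-d - q) + d = 0 := by ring
  have hl : l + (-d - l) + d = 0 := by ring
  apply (tensorDualEquiv₃ hω hp hq hl).injective
  ext y z w
  simp only [TensorProduct.AlgebraTensorModule.curry_apply, LinearMap.restrictScalars_self,
    TensorProduct.curry_apply, tensorDualEquiv₃_apply_tmul]
  exact h _ _ _ _ _ _ hp hq hl y y.2 z z.2 w w.2

end Nondegenerate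

/-! ### The coproduct dual to a quadratic perm algebra -/

section FormCoproduct

variable {k B : Type*} [Field k] [AddCommGroup B] [Module k B] {ℬ : ℤ → Submodule k B}
  [DirectSum.Decomposition ℬ] {m : B →ₗ[k] B →ₗ[k] B} {ω : B →ₗ[k] B →ₗ[k] k}

omit [DirectSum.Decomposition ℬ] in
theorem IsQuadraticGradedPermAlgebra.exists_symplectic
    (hB : IsQuadraticGradedPermAlgebra ℬ m ω) : ∃ d, IsSymplecticGradedForm ℬ ω d :=
  hB.graded.imp fun _ hd => ⟨hd, hB.skew, hB.nondegenerate⟩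

omit [DirectSum.Decomposition ℬ] in
/-- Left multiplications are self-adjoint. -/
theorem IsQuadraticGradedPermAlgebra.form_mul_left (hB : IsQuadraticGradedPermAlgebra ℬ m ω)
    (a x y : B) : ω (m a x) y = ω x (m a y) := by
  have h₁ := hB.invariant y a x
  have h₂ := hB.invariant x a y
  rw [map_sub, hB.skew (m y a)] at h₁
  rw [map_sub, hB.skew (m x a)] at h₂
  rw [hB.skew (m a x)]
  linear_combination h₁ + h₂

variable (m ω) in
/-- The component `B → B_i ⊗ B_j` of the coproduct dual to the product `m`. -/
def formCoproductComp {d : ℤ} [∀ i, Module.Finite k (ℬ i)] (hω : IsSymplecticGradedForm ℬ ω d)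
    (i j : ℤ) : B →ₗ[k] ℬ i ⊗[k] ℬ j :=
  -((tensorDualEquiv hω (show i + (-d - i) + d = 0 by ring)
      (show j + (-d - j) + d = 0 by ring)).symm.toLinearMap ∘ₗ
    (TensorProduct.lift (m.compl₁₂ (ℬ (-d - i)).subtype (ℬ (-d - j)).subtype)).dualMap ∘ₗ ω)

variable (m ω) in
/-- The coproduct on `B` dual to the product `m` with respect to `ω`. -/
def formCoproduct {d : ℤ} [∀ i, Module.Finite k (ℬ i)] (hω : IsSymplecticGradedForm ℬ ω d) :
    B →ₗ[k] CTensor ℬ :=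
  LinearMap.pi fun i => LinearMap.pi fun j => formCoproductComp m ω hω i j

theorem isFormCoproduct_formCoproduct {d : ℤ} [∀ i, Module.Finite k (ℬ i)]
    (hω : IsSymplecticGradedForm ℬ ω d) :
    IsFormCoproduct ℬ m ω (formCoproduct m ω hω) := by
  intro a b c
  induction b using DirectSum.Decomposition.inductionOn ℬ with
  | zero => simp [hatForm_zero_left]
  | add b b' hb hb' =>
    rw [hatForm_add_left hω.graded, hb, hb']
    simp only [map_add, LinearMap.add_apply]
    ring
  | @homogeneous e b =>
  induction c using DirectSum.Decomposition.inductionOn ℬ with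
  | zero => simp [hatForm_zero_right]
  | add c c' hc hc' =>
    rw [hatForm_add_right hω.graded, hc, hc']
    simp only [map_add]
    ring
  | @homogeneous e' c =>
  obtain ⟨i, rfl⟩ : ∃ i, e = -d - i := ⟨-d - e, by ring⟩
  obtain ⟨j, rfl⟩ : ∃ j, e' = -d - j := ⟨-d - e', by ring⟩
  have hi : i + (-d - i) + d = 0 := by ring
  have hj : j + (-d - j) + d = 0 := by ring
  rw [hatForm_of_mem hω.graded _ b.2 c.2 hi hj, ← tensorDualEquiv_apply_tmul hω hi hj]
  simp [formCoproduct, formCoproductComp]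

theorem IsFormCoproduct.unique {d : ℤ} [∀ i, Module.Finite k (ℬ i)]
    (hω : IsSymplecticGradedForm ℬ ω d) {N N' : B →ₗ[k] CTensor ℬ}
    (hN : IsFormCoproduct ℬ m ω N) (hN' : IsFormCoproduct ℬ m ω N') : N = N' :=
  LinearMap.ext fun a => hω.hatForm_ext fun _ _ y _ z _ => by rw [hN, hN']

variable {N : B →ₗ[k] CTensor ℬ} (hN : IsFormCoproduct ℬ m ω N)
  (hB : IsQuadraticGradedPermAlgebra ℬ m ω)
include hN hB

/-- The coproduct has degree `-d`: its component `(p, q)` vanishes outside degree `p + q + d`. -/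
theorem IsFormCoproduct.isRowFiniteCoproduct : IsRowFiniteCoproduct N := by
  have := hB.perm.finite
  obtain ⟨d, hω⟩ := hB.exists_symplectic
  refine fun p q => (Set.finite_singleton (p + q + d)).subset fun i hi => ?_
  by_contra hne
  simp only [Set.mem_singleton_iff] at hne
  refine hi (LinearMap.ext fun a => ?_)
  have hp : p + (-d - p) + d = 0 := by ring
  have hq : q + (-d - q) + d = 0 := by ring
  refine hω.eq_zero_of_pairAt hp hq fun y hy z hz => ?_
  refine (hatForm_of_mem hω.graded (N a) hy hz hp hq).symm.trans ?_
  rw [hN, neg_eq_zero]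
  exact hω.graded i _ (by omega) a a.2 _ (hB.perm.graded _ _ y hy z hz)

theorem IsFormCoproduct.cMap_left_first (a b : B) : cMap ℬ (m a) .id (N b) = N (m a b) := by
  have := hB.perm.finite
  obtain ⟨d, hω⟩ := hB.exists_symplectic
  refine hω.hatForm_ext fun i j y hy z hz => ?_
  rw [hatForm_cMap hω.graded (mem_rowFinite_left hB.perm.graded a) (hB.form_mul_left a) _ hy hz,
    hN, hN, hB.form_mul_left, hB.perm.perm.assoc]

/-- The adjoint of `r(a)` is `l(a) - r(a)`, and `(ay - ya)z = 0` in a perm algebra. -/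
theorem IsFormCoproduct.cMap_right_first (a b : B) : cMap ℬ (m.flip a) .id (N b) = 0 := by
  have := hB.perm.finite
  obtain ⟨d, hω⟩ := hB.exists_symplectic
  refine hω.hatForm_ext fun i j y hy z hz => ?_
  rw [hatForm_cMap (g := m a - m.flip a) hω.graded (mem_rowFinite_right hB.perm.graded a)
    (fun x y => hB.invariant x a y) _ hy hz, hN]
  simp [hB.perm.perm.perm a y, hatForm_eq_finsum]

theorem IsFormCoproduct.cMap_left_second (a b : B) : cMap ℬ .id (m a) (N b) = N (m a b) := by
  have := hB.perm.finite
  obtain ⟨d, hω⟩ := hB.exists_symplectic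
  refine hω.hatForm_ext fun i j y hy z hz => ?_
  rw [cMap_id_left, hatForm_flip, hatForm_cMap hω.graded
    (mem_rowFinite_left hB.perm.graded a) (hB.form_mul_left a) _ hz hy, hatForm_flip,
    hN, hN, hB.form_mul_left, hB.perm.perm.assoc, hB.perm.perm.assoc, hB.perm.perm.perm]

theorem IsFormCoproduct.cMap_right_second (a b : B) :
    cMap ℬ .id (m.flip a) (N b) = N (m b a) := by
  have := hB.perm.finite
  obtain ⟨d, hω⟩ := hB.exists_symplectic
  refine hω.hatForm_ext fun i j y hy z hz => ?_
  rw [cMap_id_left, hatForm_flip, hatForm_cMap (g := m a - m.flip a) hω.graded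
    (mem_rowFinite_right hB.perm.graded a) (fun x y => hB.invariant x a y) _ hz hy, hatForm_flip,
    hN, hN, hB.invariant]
  simp only [LinearMap.sub_apply, LinearMap.flip_apply, map_sub]
  rw [hB.perm.perm.assoc y a z, hB.perm.perm.assoc a y z, hB.perm.perm.perm a y z,
    hB.perm.perm.assoc y z a]

/-- The coproduct is symmetric on commutators. -/
theorem IsFormCoproduct.flip_commutator (a b : B) :
    flip ℬ (N (m a b) - N (m b a)) = N (m a b) - N (m b a) := by
  have := hB.perm.finite
  obtain ⟨d, hω⟩ := hB.exists_symplectic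
  rw [← map_sub]
  refine hω.hatForm_ext fun i j y hy z hz => ?_
  -- `ω(ab - ba, w) = ω(b, wa)`, and `(yz)a = (zy)a`
  have h : ∀ w, ω (m a b - m b a) w = ω b (m w a) := fun w => by
    rw [map_sub, LinearMap.sub_apply, hB.form_mul_left, hB.invariant, ← map_sub, sub_sub_cancel]
  rw [hatForm_flip, hN, hN, h, h, hB.perm.perm.perm]

section Triple

variable {d : ℤ} (hω : IsSymplecticGradedForm ℬ ω d)
  {p p' q q' l l' : ℤ} (hp : p + p' + d = 0) (hq : q + q' + d = 0) (hl : l + l' + d = 0)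
  {y z w : B} (hy : y ∈ ℬ p') (hz : z ∈ ℬ q') (hw : w ∈ ℬ l') (X : CTensor ℬ)
include hω hp hq hl hy hz hw

/-- Against homogeneous elements, `N ⊗̂ id` is adjoint to minus the product of the first two. -/
theorem IsFormCoproduct.pairAt₃_cLeft :
    pairAt₃ ℬ ω p q l y z w (cLeft N X p q l) = -hatForm ℬ ω X (m y z) w := by
  rw [cLeft, map_finsum _ (finite_support_leftTerm (hN.isRowFiniteCoproduct hB) X p q l),
    hatForm_of_mem_right hω.graded X _ hw hl, ← finsum_neg_distrib]
  refine finsum_congr fun i => ?_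
  rw [leftTerm]
  induction X i l with
  | zero => simp
  | add u v hu hv => rw [map_add, map_add, map_add, map_add, hu, hv, neg_add]
  | tmul u v =>
    rw [LinearMap.rTensor_tmul, pairAt₃_assoc, pairAt_tmul, ← neg_mul, ← hN,
      hatForm_of_mem hω.graded _ hy hz hp hq]
    rfl

/-- Against homogeneous elements, `id ⊗̂ N` is adjoint to minus the product of the last two. -/
theorem IsFormCoproduct.pairAt₃_cRight :
    pairAt₃ ℬ ω p q l y z w (cRight N X p q l) = -hatForm ℬ ω X y (m z w) := by
  rw [cRight, map_finsum _ (finite_support_rightTerm (hN.isRowFiniteCoproduct hB) X p q l),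
    hatForm_of_mem_left hω.graded X _ hy hp, ← finsum_neg_distrib]
  refine finsum_congr fun j => ?_
  rw [rightTerm]
  induction X p j with
  | zero => simp
  | add u v hu hv => rw [map_add, map_add, map_add, hu, hv, neg_add]
  | tmul u v =>
    rw [LinearMap.lTensor_tmul, pairAt₃_tmul, pairAt_tmul, ← mul_neg, ← hN,
      hatForm_of_mem hω.graded _ hz hw hq hl]
    rfl

end Triple

theorem IsFormCoproduct.cRight_eq_cLeft (a : B) : cRight N (N a) = cLeft N (N a) := by
  have := hB.perm.finite
  obtain ⟨d, hω⟩ := hB.exists_symplectic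
  refine hω.ext₃ fun p p' q q' l l' hp hq hl y hy z hz w hw => ?_
  rw [hN.pairAt₃_cLeft hB hω hp hq hl hy hz hw, hN.pairAt₃_cRight hB hω hp hq hl hy hz hw,
    hN, hN, hB.perm.perm.assoc]

theorem IsFormCoproduct.flip₁₂_cLeft (a : B) : flip₁₂ ℬ (cLeft N (N a)) = cLeft N (N a) := by
  have := hB.perm.finite
  obtain ⟨d, hω⟩ := hB.exists_symplectic
  refine hω.ext₃ fun p p' q q' l l' hp hq hl y hy z hz w hw => ?_
  rw [flip₁₂, pairAt₃_leftComm, hN.pairAt₃_cLeft hB hω hp hq hl hy hz hw,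
    hN.pairAt₃_cLeft hB hω hq hp hl hz hy hw, hN, hN, hB.perm.perm.perm]

end FormCoproduct

/-! ### Completed tensor products over `P ⊗ B` -/

section Bullet

variable {k P B : Type*} [Field k] [AddCommGroup P] [Module k P] [AddCommGroup B] [Module k B]
  {ℬ : ℤ → Submodule k B}

variable (ℬ) in
/-- The bilinear map `(X, Y) ↦ X • Y` from `P ⊗ P` and `B ⊗̂ B` to `(P ⊗ B) ⊗̂ (P ⊗ B)`. -/
def bulletₗ : P ⊗[k] P →ₗ[k] CTensor ℬ →ₗ[k] CTensor (tensorGrading P ℬ) :=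
  LinearMap.mk₂ k (fun X Y i j => bulletComp ℬ i j (X ⊗ₜ Y i j))
    (fun X X' Y => by funext i j; simp [TensorProduct.add_tmul])
    (fun c X Y => by funext i j; simp [← TensorProduct.smul_tmul'])
    (fun X Y Y' => by funext i j; simp [TensorProduct.tmul_add])
    (fun c X Y => by funext i j; simp)

theorem bulletₗ_apply (X : P ⊗[k] P) (Y : CTensor ℬ) (i j : ℤ) :
    bulletₗ ℬ X Y i j = bulletComp ℬ i j (X ⊗ₜ Y i j) := rfl

theorem bullet_tmul (D : P →ₗ[k] P ⊗[k] P) (N : B →ₗ[k] CTensor ℬ) (p : P) (b : B) :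
    bullet ℬ D N (p ⊗ₜ b) = bulletₗ ℬ (D p) (N b) := rfl

theorem bulletComp_tmul (i j : ℤ) (p q : P) (b : ℬ i) (c : ℬ j) :
    bulletComp ℬ i j ((p ⊗ₜ q) ⊗ₜ (b ⊗ₜ c)) =
      toTensorGrading P ℬ i (p ⊗ₜ b) ⊗ₜ toTensorGrading P ℬ j (q ⊗ₜ c) := rfl

variable (P ℬ) in
theorem toTensorGrading_surjective (i : ℤ) : Function.Surjective (toTensorGrading P ℬ i) :=
  LinearMap.surjective_rangeRestrict _

theorem flip_bulletₗ (X : P ⊗[k] P) (Y : CTensor ℬ) :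
    flip _ (bulletₗ ℬ X Y) = bulletₗ ℬ (TensorProduct.comm k P P X) (flip ℬ Y) := by
  funext i j
  simp only [flip, bulletₗ_apply]
  generalize Y j i = y
  induction X with
  | zero => simp
  | add X X' hX hX' => simp only [TensorProduct.add_tmul, map_add, hX, hX']
  | tmul p q =>
    induction y with
    | zero => simp
    | add y y' hy hy' => simp only [TensorProduct.tmul_add, map_add, hy, hy']
    | tmul b c => simp [bulletComp_tmul]

variable (P ℬ) in
/-- `(p ⊗ (p' ⊗ p'')) • (b ⊗ (b' ⊗ b''))` on the `(i, j, l)` component. -/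
def bulletComp₃ (i j l : ℤ) : (P ⊗[k] (P ⊗[k] P)) ⊗[k] (ℬ i ⊗[k] (ℬ j ⊗[k] ℬ l)) →ₗ[k]
    tensorGrading P ℬ i ⊗[k] (tensorGrading P ℬ j ⊗[k] tensorGrading P ℬ l) :=
  TensorProduct.map (toTensorGrading P ℬ i) (bulletComp ℬ j l) ∘ₗ
    (TensorProduct.tensorTensorTensorComm k P (P ⊗[k] P) (ℬ i) (ℬ j ⊗[k] ℬ l)).toLinearMap

theorem bulletComp₃_tmul (i j l : ℤ) (p : P) (X : P ⊗[k] P) (b : ℬ i) (y : ℬ j ⊗[k] ℬ l) :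
    bulletComp₃ P ℬ i j l ((p ⊗ₜ X) ⊗ₜ (b ⊗ₜ y)) =
      toTensorGrading P ℬ i (p ⊗ₜ b) ⊗ₜ bulletComp ℬ j l (X ⊗ₜ y) := rfl

theorem bulletComp₃_assoc (i j l : ℤ) (X : P ⊗[k] P) (p : P) (y : ℬ i ⊗[k] ℬ j) (b : ℬ l) :
    bulletComp₃ P ℬ i j l
        (TensorProduct.assoc k P P P (X ⊗ₜ p) ⊗ₜ TensorProduct.assoc k _ _ _ (y ⊗ₜ b)) =
      TensorProduct.assoc k _ _ _
        (bulletComp ℬ i j (X ⊗ₜ y) ⊗ₜ toTensorGrading P ℬ l (p ⊗ₜ b)) := by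
  induction X with
  | zero => simp
  | add X X' hX hX' => simp only [TensorProduct.add_tmul, map_add, hX, hX']
  | tmul p q =>
    induction y with
    | zero => simp
    | add y y' hy hy' => simp only [TensorProduct.add_tmul, TensorProduct.tmul_add, map_add, hy, hy']
    | tmul b c => rfl

variable (ℬ) in
/-- The bilinear map `(X, Y) ↦ X • Y` on threefold tensor products. -/
def bullet₃ₗ : P ⊗[k] (P ⊗[k] P) →ₗ[k] CTensor₃ ℬ →ₗ[k] CTensor₃ (tensorGrading P ℬ) :=
  LinearMap.mk₂ k (fun X Y i j l => bulletComp₃ P ℬ i j l (X ⊗ₜ Y i j l))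
    (fun X X' Y => by funext i j l; simp [TensorProduct.add_tmul])
    (fun c X Y => by funext i j l; simp [← TensorProduct.smul_tmul'])
    (fun X Y Y' => by funext i j l; simp [TensorProduct.tmul_add])
    (fun c X Y => by funext i j l; simp)

theorem bullet₃ₗ_apply (X : P ⊗[k] (P ⊗[k] P)) (Y : CTensor₃ ℬ) (i j l : ℤ) :
    bullet₃ₗ ℬ X Y i j l = bulletComp₃ P ℬ i j l (X ⊗ₜ Y i j l) := rfl

theorem flip₁₂_bullet₃ₗ (X : P ⊗[k] (P ⊗[k] P)) (Y : CTensor₃ ℬ) :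
    flip₁₂ _ (bullet₃ₗ ℬ X Y) = bullet₃ₗ ℬ (TensorProduct.leftComm k P P P X) (flip₁₂ ℬ Y) := by
  funext i j l
  simp only [flip₁₂, bullet₃ₗ_apply]
  generalize Y j i l = y
  induction X with
  | zero => simp
  | add X X' hX hX' => simp only [TensorProduct.add_tmul, map_add, hX, hX']
  | tmul p X =>
    induction X with
    | zero => simp
    | add X X' hX hX' => simp only [TensorProduct.add_tmul, TensorProduct.tmul_add, map_add, hX, hX']
    | tmul p' p'' =>
      induction y with
      | zero => simp
      | add y y' hy hy' => simp only [TensorProduct.tmul_add, map_add, hy, hy']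
      | tmul b y =>
        induction y with
        | zero => simp
        | add y y' hy hy' => simp only [TensorProduct.tmul_add, map_add, hy, hy']
        | tmul b' b'' =>
          simp [bulletComp₃_tmul, bulletComp_tmul]

variable {N : B →ₗ[k] CTensor ℬ} (hN : IsRowFiniteCoproduct N) (D : P →ₗ[k] P ⊗[k] P)

theorem comp_bullet_toTensorGrading (p q i : ℤ) :
    (comp (bullet ℬ D N) p q ∘ₗ (tensorGrading P ℬ i).subtype) ∘ₗ toTensorGrading P ℬ i =
      bulletComp ℬ p q ∘ₗ TensorProduct.map D (comp N p q ∘ₗ (ℬ i).subtype) := by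
  ext x b
  rfl

include hN in
theorem IsRowFiniteCoproduct.bullet : IsRowFiniteCoproduct (bullet ℬ D N) := by
  refine fun p q => (hN p q).subset fun i hi h => hi ?_
  rw [← LinearMap.cancel_right (toTensorGrading_surjective P ℬ i), comp_bullet_toTensorGrading,
    h, TensorProduct.map_zero_right, LinearMap.comp_zero, LinearMap.zero_comp]

theorem comp_bullet_apply (p q i : ℤ) (x : P) (b : ℬ i) :
    comp (CompletedDPP.bullet ℬ D N) p q (toTensorGrading P ℬ i (x ⊗ₜ b)) =
      bulletComp ℬ p q (D x ⊗ₜ comp N p q b) := rfl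

theorem leftTerm_bulletₗ (X : P ⊗[k] P) (Y : CTensor ℬ) (p q l i : ℤ) :
    leftTerm (bullet ℬ D N) (bulletₗ ℬ X Y) p q l i =
      bulletComp₃ P ℬ p q l
        (TensorProduct.assoc k P P P (D.rTensor P X) ⊗ₜ leftTerm N Y p q l i) := by
  simp only [leftTerm, bulletₗ_apply]
  generalize Y i l = y
  induction X with
  | zero => simp
  | add X X' hX hX' => simp only [TensorProduct.add_tmul, map_add, hX, hX']
  | tmul x x' =>
    induction y with
    | zero => simp
    | add y y' hy hy' => simp only [TensorProduct.tmul_add, map_add, hy, hy']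
    | tmul b c =>
      simp only [LinearMap.rTensor_tmul, bulletComp_tmul, bulletComp₃_assoc, LinearMap.comp_apply,
        Submodule.subtype_apply, comp_bullet_apply]

theorem rightTerm_bulletₗ (X : P ⊗[k] P) (Y : CTensor ℬ) (p q l j : ℤ) :
    rightTerm (bullet ℬ D N) (bulletₗ ℬ X Y) p q l j =
      bulletComp₃ P ℬ p q l (D.lTensor P X ⊗ₜ rightTerm N Y p q l j) := by
  simp only [rightTerm, bulletₗ_apply]
  generalize Y p j = y
  induction X with
  | zero => simp
  | add X X' hX hX' => simp only [TensorProduct.add_tmul, map_add, hX, hX']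
  | tmul x x' =>
    induction y with
    | zero => simp
    | add y y' hy hy' => simp only [TensorProduct.tmul_add, map_add, hy, hy']
    | tmul b c =>
      simp only [LinearMap.lTensor_tmul, bulletComp_tmul, bulletComp₃_tmul, LinearMap.comp_apply,
        Submodule.subtype_apply, comp_bullet_apply]

include hN

theorem cLeft_bulletₗ (X : P ⊗[k] P) (Y : CTensor ℬ) :
    cLeft (bullet ℬ D N) (bulletₗ ℬ X Y) =
      bullet₃ₗ ℬ (TensorProduct.assoc k P P P (D.rTensor P X)) (cLeft N Y) := by
  funext p q l
  rw [bullet₃ₗ_apply, cLeft, cLeft]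
  simp only [leftTerm_bulletₗ]
  exact (map_finsum (bulletComp₃ P ℬ p q l ∘ₗ TensorProduct.mk k _ _ _)
    (finite_support_leftTerm hN Y p q l)).symm

theorem cRight_bulletₗ (X : P ⊗[k] P) (Y : CTensor ℬ) :
    cRight (bullet ℬ D N) (bulletₗ ℬ X Y) = bullet₃ₗ ℬ (D.lTensor P X) (cRight N Y) := by
  funext p q l
  rw [bullet₃ₗ_apply, cRight, cRight]
  simp only [rightTerm_bulletₗ]
  exact (map_finsum (bulletComp₃ P ℬ p q l ∘ₗ TensorProduct.mk k _ _ _)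
    (finite_support_rightTerm hN Y p q l)).symm

end Bullet

section Operators

variable {k P B : Type*} [Field k] [AddCommGroup P] [Module k P] [AddCommGroup B] [Module k B]
  {ℬ : ℤ → Submodule k B} [DirectSum.Decomposition ℬ]

theorem proj_tmul (i : ℤ) (p : P) (b : B) :
    proj (tensorGrading P ℬ) i (p ⊗ₜ b) = toTensorGrading P ℬ i (p ⊗ₜ proj ℬ i b) := by
  induction b using DirectSum.Decomposition.inductionOn ℬ with
  | zero => simp
  | add b b' hb hb' => simp only [TensorProduct.tmul_add, map_add, hb, hb']
  | @homogeneous e b =>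
    have hmem : (p ⊗ₜ (b : B)) ∈ tensorGrading P ℬ e := ⟨p ⊗ₜ b, rfl⟩
    by_cases he : e = i
    · subst he
      rw [proj_coe]
      exact proj_coe (tensorGrading P ℬ) e ⟨_, hmem⟩
    · rw [proj_of_mem ℬ b.2 he, proj_of_mem _ hmem he]
      simp

theorem block_map_toTensorGrading (g : P →ₗ[k] P) (h : B →ₗ[k] B) (i j : ℤ) :
    block (tensorGrading P ℬ) (TensorProduct.map g h) i j ∘ₗ toTensorGrading P ℬ i =
      toTensorGrading P ℬ j ∘ₗ TensorProduct.map g (block ℬ h i j) := by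
  ext p b : 3
  exact proj_tmul j (g p) (h b)

theorem cMap_map_first (g : P →ₗ[k] P) {h : B →ₗ[k] B} (hh : h ∈ rowFinite ℬ) (X : P ⊗[k] P)
    (Y : CTensor ℬ) :
    cMap _ (TensorProduct.map g h) .id (bulletₗ ℬ X Y) =
      bulletₗ ℬ (g.rTensor P X) (cMap ℬ h .id Y) := by
  funext p q
  rw [cMap_id_right, bulletₗ_apply, cMap_id_right]
  refine Eq.trans ?_ (map_finsum (bulletComp ℬ p q ∘ₗ TensorProduct.mk k _ _ (g.rTensor P X))
    (finite_support_rTensor_block hh Y p q)).symm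
  refine finsum_congr fun i => ?_
  rw [bulletₗ_apply, LinearMap.comp_apply, TensorProduct.mk_apply]
  generalize Y i q = y
  induction X with
  | zero => simp
  | add X X' hX hX' => simp only [TensorProduct.add_tmul, map_add, hX, hX']
  | tmul x x' =>
    induction y with
    | zero => simp
    | add y y' hy hy' => simp only [TensorProduct.tmul_add, map_add, hy, hy']
    | tmul b c =>
      simp only [LinearMap.rTensor_tmul, bulletComp_tmul]
      exact congrArg (· ⊗ₜ[k] _)
        (LinearMap.congr_fun (block_map_toTensorGrading g h i p) (x ⊗ₜ b))

theorem cMap_map_second (g : P →ₗ[k] P) {h : B →ₗ[k] B} (hh : h ∈ rowFinite ℬ) (X : P ⊗[k] P)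
    (Y : CTensor ℬ) :
    cMap _ .id (TensorProduct.map g h) (bulletₗ ℬ X Y) =
      bulletₗ ℬ (g.lTensor P X) (cMap ℬ .id h Y) := by
  rw [cMap_id_left, flip_bulletₗ, cMap_map_first g hh, flip_bulletₗ, ← cMap_id_left]
  congr 2
  induction X with
  | zero => simp
  | add X X' hX hX' => simp only [map_add, hX, hX']
  | tmul x x' => simp

theorem tensorMul_tmul (f : P →ₗ[k] P →ₗ[k] P) (m : B →ₗ[k] B →ₗ[k] B) (p : P) (b : B) :
    tensorMul f m (p ⊗ₜ b) = TensorProduct.map (f p) (m b) := rfl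

theorem tensorMul_flip_tmul (f : P →ₗ[k] P →ₗ[k] P) (m : B →ₗ[k] B →ₗ[k] B) (p : P) (b : B) :
    (tensorMul f m).flip (p ⊗ₜ b) = TensorProduct.map (f.flip p) (m.flip b) := by
  ext q c
  rfl

omit [DirectSum.Decomposition ℬ] in
theorem isGradedMul_tensorMul (f : P →ₗ[k] P →ₗ[k] P) {m : B →ₗ[k] B →ₗ[k] B}
    (hm : IsGradedMul ℬ m) : IsGradedMul (tensorGrading P ℬ) (tensorMul f m) := by
  rintro i j _ ⟨x, rfl⟩ _ ⟨y, rfl⟩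
  induction x with
  | zero => simp
  | add x x' hx hx' =>
    simp only [map_add, LinearMap.add_apply]
    exact add_mem hx hx'
  | tmul p b =>
    induction y with
    | zero => simp
    | add y y' hy hy' =>
      simp only [map_add]
      exact add_mem hy hy'
    | tmul q c => exact ⟨f p q ⊗ₜ ⟨m b c, hm i j b b.2 c c.2⟩, rfl⟩

end Operators

/-! ### The algebra and coalgebra structures on `P ⊗ B` -/

section Ext

variable {k P B V : Type*} [Field k] [AddCommGroup P] [Module k P] [AddCommGroup B] [Module k B]
  [AddCommGroup V] [Module k V]

theorem tmul_ext₂ {F G : P ⊗[k] B →ₗ[k] P ⊗[k] B →ₗ[k] V}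
    (h : ∀ p b q c, F (p ⊗ₜ b) (q ⊗ₜ c) = G (p ⊗ₜ b) (q ⊗ₜ c)) : F = G :=
  TensorProduct.ext' fun p b => TensorProduct.ext' fun q c => h p b q c

theorem tmul_ext₃ {F G : P ⊗[k] B →ₗ[k] P ⊗[k] B →ₗ[k] P ⊗[k] B →ₗ[k] V}
    (h : ∀ p b q c r e, F (p ⊗ₜ b) (q ⊗ₜ c) (r ⊗ₜ e) = G (p ⊗ₜ b) (q ⊗ₜ c) (r ⊗ₜ e)) :
    F = G :=
  tmul_ext₂ fun p b q c => TensorProduct.ext' fun r e => h p b q c r e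

theorem congr_fun₃ {F G : P ⊗[k] B →ₗ[k] P ⊗[k] B →ₗ[k] P ⊗[k] B →ₗ[k] V} (h : F = G)
    (x y z : P ⊗[k] B) : F x y z = G x y z := by rw [h]

end Ext

section Algebra

variable {k P B : Type*} [Field k] [AddCommGroup P] [Module k P] [AddCommGroup B] [Module k B]
  {mulP brP : P →ₗ[k] P →ₗ[k] P} (m : B →ₗ[k] B →ₗ[k] B)

/-- The product `(x, y, z) ↦ f(x, g(y, z))` as a trilinear map. -/
def rightNested {A : Type*} [AddCommGroup A] [Module k A] (f g : A →ₗ[k] A →ₗ[k] A) :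
    A →ₗ[k] A →ₗ[k] A →ₗ[k] A :=
  (LinearMap.llcomp k A A A).compl₁₂ f g

variable {m}

theorem isPermAlgebra_tensorMul (hP : IsPoissonAlgebra mulP brP) (hm : IsPermAlgebra m) :
    IsPermAlgebra (tensorMul mulP m) where
  assoc := congr_fun₃ (F := rightNested (tensorMul mulP m) (tensorMul mulP m))
    (G := (tensorMul mulP m).compr₂ (tensorMul mulP m)) <| tmul_ext₃ fun p b q c r e => by
      change mulP p (mulP q r) ⊗ₜ[k] m b (m c e) = mulP (mulP p q) r ⊗ₜ[k] m (m b c) e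
      rw [hP.assoc, hm.assoc]
  perm := congr_fun₃ (F := (tensorMul mulP m).compr₂ (tensorMul mulP m))
    (G := ((tensorMul mulP m).compr₂ (tensorMul mulP m)).flip) <| tmul_ext₃ fun p b q c r e => by
      change mulP (mulP p q) r ⊗ₜ[k] m (m b c) e = mulP (mulP q p) r ⊗ₜ[k] m (m c b) e
      rw [hP.comm p q, hm.perm b c]

theorem isLeibnizAlgebra_tensorMul (hP : IsPoissonAlgebra mulP brP) (hm : IsPermAlgebra m) :
    IsLeibnizAlgebra (tensorMul brP m) where
  leibniz := congr_fun₃ (F := rightNested (tensorMul brP m) (tensorMul brP m))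
    (G := (tensorMul brP m).compr₂ (tensorMul brP m)
      + (rightNested (tensorMul brP m) (tensorMul brP m)).flip) <|
    tmul_ext₃ fun p b q c r e => by
      change brP p (brP q r) ⊗ₜ[k] m b (m c e) = brP (brP p q) r ⊗ₜ[k] m (m b c) e
        + brP q (brP p r) ⊗ₜ[k] m c (m b e)
      have h := hP.jacobi p q r
      rw [hP.antisymm r p, hP.antisymm r (brP p q), map_neg] at h
      rw [hm.assoc b c e, hm.assoc c b e, hm.perm c b, ← TensorProduct.add_tmul]
      congr 1
      rw [← sub_eq_zero, ← h]
      abel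

theorem isDPPAlgebra_tensorMul (hP : IsPoissonAlgebra mulP brP) (hm : IsPermAlgebra m) :
    IsDPPAlgebra (tensorMul mulP m) (tensorMul brP m) where
  perm := isPermAlgebra_tensorMul hP hm
  leibniz := isLeibnizAlgebra_tensorMul hP hm
  compat₁ := congr_fun₃ (F := (tensorMul mulP m).compr₂ (tensorMul brP m))
    (G := rightNested (tensorMul mulP m) (tensorMul brP m)
      + (rightNested (tensorMul mulP m) (tensorMul brP m)).flip) <|
    tmul_ext₃ fun p b q c r e => by
      change brP (mulP p q) r ⊗ₜ[k] m (m b c) e = mulP p (brP q r) ⊗ₜ[k] m b (m c e)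
        + mulP q (brP p r) ⊗ₜ[k] m c (m b e)
      rw [hm.assoc b c e, hm.assoc c b e, hm.perm c b, ← TensorProduct.add_tmul, hP.antisymm,
        hP.leibniz, hP.antisymm q r, hP.antisymm p r, hP.comm (brP r p), map_neg, map_neg]
      congr 1
      abel
  compat₂ a b c := eq_sub_of_add_eq <| congr_fun₃
    (F := (tensorMul brP m).compr₂ (tensorMul mulP m)
      + (rightNested (tensorMul mulP m) (tensorMul brP m)).flip)
    (G := rightNested (tensorMul brP m) (tensorMul mulP m)) (tmul_ext₃ fun p b q c r e => by
      change mulP (brP p q) r ⊗ₜ[k] m (m b c) e + mulP q (brP p r) ⊗ₜ[k] m c (m b e)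
        = brP p (mulP q r) ⊗ₜ[k] m b (m c e)
      rw [hm.assoc b c e, hm.assoc c b e, hm.perm c b, ← TensorProduct.add_tmul, hP.leibniz])
    a b c
  compat₃ a b c := eq_neg_of_add_eq_zero_left <| congr_fun₃
    (F := (tensorMul brP m).compr₂ (tensorMul mulP m)
      + ((tensorMul brP m).compr₂ (tensorMul mulP m)).flip) (G := 0)
    (tmul_ext₃ fun p b q c r e => by
      change mulP (brP p q) r ⊗ₜ[k] m (m b c) e + mulP (brP q p) r ⊗ₜ[k] m (m c b) e = 0
      rw [hP.antisymm p q, hm.perm b c, map_neg, LinearMap.neg_apply, TensorProduct.neg_tmul,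
        neg_add_cancel])
    a b c

end Algebra

section Coalgebra

variable {k P : Type*} [Field k] [AddCommGroup P] [Module k P]

theorem leftComm_assoc_rTensor (D : P →ₗ[k] P ⊗[k] P) (X : P ⊗[k] P) :
    TensorProduct.leftComm k P P P (TensorProduct.assoc k P P P (D.rTensor P X)) =
      TensorProduct.assoc k P P P
        (((TensorProduct.comm k P P).toLinearMap ∘ₗ D).rTensor P X) := by
  induction X with
  | zero => simp
  | add X Y hX hY => simp only [map_add, hX, hY]
  | tmul x y =>
    simp only [LinearMap.rTensor_tmul, LinearMap.comp_apply, LinearEquiv.coe_coe]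
    induction D x with
    | zero => simp
    | add X Y hX hY => simp only [map_add, TensorProduct.add_tmul, hX, hY]
    | tmul u v => rfl

/-- The cyclic permutation `x ⊗ (y ⊗ z) ↦ y ⊗ (z ⊗ x)`. -/
def cyc : P ⊗[k] (P ⊗[k] P) ≃ₗ[k] P ⊗[k] (P ⊗[k] P) :=
  TensorProduct.comm k P (P ⊗[k] P) ≪≫ₗ TensorProduct.assoc k P P P

theorem cyc_lTensor (D : P →ₗ[k] P ⊗[k] P) (X : P ⊗[k] P) :
    cyc (D.lTensor P X) =
      TensorProduct.assoc k P P P (D.rTensor P (TensorProduct.comm k P P X)) := by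
  induction X with
  | zero => simp
  | add X Y hX hY => simp only [map_add, hX, hY]
  | tmul x y => simp [cyc]

theorem cyc_assoc_rTensor (D : P →ₗ[k] P ⊗[k] P) (X : P ⊗[k] P) :
    cyc (TensorProduct.assoc k P P P (D.rTensor P X)) =
      TensorProduct.leftComm k P P P
        (((TensorProduct.comm k P P).toLinearMap ∘ₗ D).lTensor P
          (TensorProduct.comm k P P X)) := by
  induction X with
  | zero => simp
  | add X Y hX hY => simp only [map_add, hX, hY]
  | tmul x y =>
    simp only [LinearMap.rTensor_tmul, TensorProduct.comm_tmul, LinearMap.lTensor_tmul,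
      LinearMap.comp_apply, LinearEquiv.coe_coe]
    induction D x with
    | zero => simp
    | add X Y hX hY => simp only [map_add, TensorProduct.add_tmul, TensorProduct.tmul_add, hX, hY]
    | tmul u v => rfl

theorem cyc_leftComm_lTensor (D : P →ₗ[k] P ⊗[k] P) (X : P ⊗[k] P) :
    cyc (TensorProduct.leftComm k P P P (D.lTensor P X)) =
      ((TensorProduct.comm k P P).toLinearMap ∘ₗ D).lTensor P X := by
  induction X with
  | zero => simp
  | add X Y hX hY => simp only [map_add, hX, hY]
  | tmul x y =>
    simp only [LinearMap.lTensor_tmul, LinearMap.comp_apply, LinearEquiv.coe_coe]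
    induction D y with
    | zero => simp
    | add X Y hX hY => simp only [map_add, TensorProduct.tmul_add, hX, hY]
    | tmul u v => rfl

variable {Δ δ : P →ₗ[k] P ⊗[k] P} (hC : IsPoissonCoalgebra Δ δ)
include hC

theorem IsPoissonCoalgebra.comm_comp_Δ : (TensorProduct.comm k P P).toLinearMap ∘ₗ Δ = Δ :=
  LinearMap.ext hC.cocomm

theorem IsPoissonCoalgebra.comm_comp_δ : (TensorProduct.comm k P P).toLinearMap ∘ₗ δ = -δ :=
  LinearMap.ext hC.coantisymm

/-- The dual of the identity `[ab, c] = a[b, c] + b[a, c]`. -/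
theorem IsPoissonCoalgebra.coleibniz' (a : P) :
    TensorProduct.assoc k P P P (Δ.rTensor P (δ a)) =
      δ.lTensor P (Δ a) + TensorProduct.leftComm k P P P (δ.lTensor P (Δ a)) := by
  have h := congrArg cyc (hC.coleibniz a)
  rw [map_add, cyc_lTensor, cyc_assoc_rTensor, cyc_leftComm_lTensor, hC.comm_comp_δ,
    hC.coantisymm, hC.cocomm, LinearMap.lTensor_neg] at h
  simp only [map_neg, LinearMap.neg_apply] at h
  rw [← neg_inj, h]
  abel

theorem IsPoissonCoalgebra.add_leftComm_eq_zero (a : P) :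
    TensorProduct.assoc k P P P (δ.rTensor P (Δ a)) +
      TensorProduct.leftComm k P P P (TensorProduct.assoc k P P P (δ.rTensor P (Δ a))) = 0 := by
  rw [leftComm_assoc_rTensor, hC.comm_comp_δ, LinearMap.rTensor_neg, LinearMap.neg_apply, map_neg,
    add_neg_cancel]

end Coalgebra

section CompletedCoalgebra

variable {k P B : Type*} [Field k] [AddCommGroup P] [Module k P] [AddCommGroup B] [Module k B]
  {ℬ : ℤ → Submodule k B} [DirectSum.Decomposition ℬ] {m : B →ₗ[k] B →ₗ[k] B}
  {ω : B →ₗ[k] B →ₗ[k] k} {N : B →ₗ[k] CTensor ℬ} (hN : IsFormCoproduct ℬ m ω N)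
  (hB : IsQuadraticGradedPermAlgebra ℬ m ω) {Δ δ : P →ₗ[k] P ⊗[k] P}
  (hC : IsPoissonCoalgebra Δ δ)
include hN hB

theorem IsFormCoproduct.isRowFinite_bullet (D : P →ₗ[k] P ⊗[k] P) :
    IsRowFiniteCoproduct (bullet ℬ D N) :=
  (hN.isRowFiniteCoproduct hB).bullet D

theorem IsFormCoproduct.cLeft_bullet_tmul (D D' : P →ₗ[k] P ⊗[k] P) (p : P) (b : B) :
    cLeft (bullet ℬ D N) (bullet ℬ D' N (p ⊗ₜ b)) =
      bullet₃ₗ ℬ (TensorProduct.assoc k P P P (D.rTensor P (D' p))) (cLeft N (N b)) := by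
  rw [bullet_tmul, cLeft_bulletₗ (hN.isRowFiniteCoproduct hB)]

theorem IsFormCoproduct.cRight_bullet_tmul (D D' : P →ₗ[k] P ⊗[k] P) (p : P) (b : B) :
    cRight (bullet ℬ D N) (bullet ℬ D' N (p ⊗ₜ b)) =
      bullet₃ₗ ℬ (D.lTensor P (D' p)) (cLeft N (N b)) := by
  rw [bullet_tmul, cRight_bulletₗ (hN.isRowFiniteCoproduct hB), hN.cRight_eq_cLeft hB]

theorem IsFormCoproduct.flip₁₂_bullet₃ₗ_cLeft (X : P ⊗[k] (P ⊗[k] P)) (b : B) :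
    flip₁₂ _ (bullet₃ₗ ℬ X (cLeft N (N b))) =
      bullet₃ₗ ℬ (TensorProduct.leftComm k P P P X) (cLeft N (N b)) := by
  rw [flip₁₂_bullet₃ₗ, hN.flip₁₂_cLeft hB]

include hC

theorem isCompletedPermCoalgebra_bullet :
    IsCompletedPermCoalgebra (tensorGrading P ℬ) (bullet ℬ Δ N) where
  extends_to a := (hN.isRowFinite_bullet hB Δ).extendsTo _
  coassoc := LinearMap.congr_fun (f := cLeftₗ (hN.isRowFinite_bullet hB Δ) ∘ₗ bullet ℬ Δ N)
    (g := cRightₗ (hN.isRowFinite_bullet hB Δ) ∘ₗ bullet ℬ Δ N) <|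
    TensorProduct.ext' fun p b => by
      change cLeft _ _ = cRight _ _
      rw [hN.cLeft_bullet_tmul hB, hN.cRight_bullet_tmul hB, hC.coassoc]
  coperm := LinearMap.congr_fun (f := cRightₗ (hN.isRowFinite_bullet hB Δ) ∘ₗ bullet ℬ Δ N)
    (g := flip₁₂ₗ _ ∘ₗ cLeftₗ (hN.isRowFinite_bullet hB Δ) ∘ₗ bullet ℬ Δ N) <|
    TensorProduct.ext' fun p b => by
      change cRight _ _ = flip₁₂ _ (cLeft _ _)
      rw [hN.cLeft_bullet_tmul hB, hN.cRight_bullet_tmul hB, hN.flip₁₂_bullet₃ₗ_cLeft hB,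
        leftComm_assoc_rTensor, hC.comm_comp_Δ, hC.coassoc]

theorem isCompletedLeibnizCoalgebra_bullet :
    IsCompletedLeibnizCoalgebra (tensorGrading P ℬ) (bullet ℬ δ N) where
  extends_to a := (hN.isRowFinite_bullet hB δ).extendsTo _
  coleibniz := LinearMap.congr_fun (f := cRightₗ (hN.isRowFinite_bullet hB δ) ∘ₗ bullet ℬ δ N)
    (g := cLeftₗ (hN.isRowFinite_bullet hB δ) ∘ₗ bullet ℬ δ N
      + flip₁₂ₗ _ ∘ₗ cRightₗ (hN.isRowFinite_bullet hB δ) ∘ₗ bullet ℬ δ N) <|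
    TensorProduct.ext' fun p b => by
      change cRight _ _ = cLeft _ _ + flip₁₂ _ (cRight _ _)
      rw [hN.cLeft_bullet_tmul hB, hN.cRight_bullet_tmul hB, hN.flip₁₂_bullet₃ₗ_cLeft hB,
        ← hC.cojacobi, ← LinearMap.add_apply, ← map_add, sub_add_cancel]

theorem cLeft_add_flip₁₂_cLeft (a : P ⊗[k] B) :
    cLeft (bullet ℬ δ N) (bullet ℬ Δ N a) +
      flip₁₂ (tensorGrading P ℬ) (cLeft (bullet ℬ δ N) (bullet ℬ Δ N a)) = 0 := by
  refine LinearMap.congr_fun (f := cLeftₗ (hN.isRowFinite_bullet hB δ) ∘ₗ bullet ℬ Δ N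
    + flip₁₂ₗ _ ∘ₗ cLeftₗ (hN.isRowFinite_bullet hB δ) ∘ₗ bullet ℬ Δ N) (g := 0)
    (TensorProduct.ext' fun p b => ?_) a
  change cLeft _ _ + flip₁₂ _ (cLeft _ _) = 0
  rw [hN.cLeft_bullet_tmul hB, hN.flip₁₂_bullet₃ₗ_cLeft hB, ← LinearMap.add_apply, ← map_add,
    hC.add_leftComm_eq_zero, map_zero]
  rfl

theorem isCompletedDPPCoalgebra_bullet :
    IsCompletedDPPCoalgebra (tensorGrading P ℬ) (bullet ℬ Δ N) (bullet ℬ δ N) where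
  perm := isCompletedPermCoalgebra_bullet hN hB hC
  leibniz := isCompletedLeibnizCoalgebra_bullet hN hB hC
  extends_to₁ a := (hN.isRowFinite_bullet hB Δ).extendsTo _
  extends_to₂ a := (hN.isRowFinite_bullet hB δ).extendsTo _
  compat₁ := LinearMap.congr_fun (f := cRightₗ (hN.isRowFinite_bullet hB Δ) ∘ₗ bullet ℬ δ N)
    (g := cLeftₗ (hN.isRowFinite_bullet hB δ) ∘ₗ bullet ℬ Δ N
      + flip₁₂ₗ _ ∘ₗ cRightₗ (hN.isRowFinite_bullet hB δ) ∘ₗ bullet ℬ Δ N) <|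
    TensorProduct.ext' fun p b => by
      change cRight _ _ = cLeft _ _ + flip₁₂ _ (cRight _ _)
      rw [hN.cLeft_bullet_tmul hB, hN.cRight_bullet_tmul hB, hN.cRight_bullet_tmul hB,
        hN.flip₁₂_bullet₃ₗ_cLeft hB, hC.coleibniz, map_add, LinearMap.add_apply]
  compat₂ := LinearMap.congr_fun (f := cLeftₗ (hN.isRowFinite_bullet hB Δ) ∘ₗ bullet ℬ δ N)
    (g := cRightₗ (hN.isRowFinite_bullet hB δ) ∘ₗ bullet ℬ Δ N
      + flip₁₂ₗ _ ∘ₗ cRightₗ (hN.isRowFinite_bullet hB δ) ∘ₗ bullet ℬ Δ N) <|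
    TensorProduct.ext' fun p b => by
      change cLeft _ _ = cRight _ _ + flip₁₂ _ (cRight _ _)
      rw [hN.cLeft_bullet_tmul hB, hN.cRight_bullet_tmul hB,
        hN.flip₁₂_bullet₃ₗ_cLeft hB, hC.coleibniz', map_add, LinearMap.add_apply]
  compat₃ a := eq_neg_of_add_eq_zero_left (cLeft_add_flip₁₂_cLeft hN hB hC a)

end CompletedCoalgebra

/-! ### The compatibility conditions on pure tensors -/

section Compatibility

set_option linter.unusedSimpArgs false

variable {k P B V M : Type*} [Field k] [AddCommGroup P] [Module k P] [AddCommGroup B] [Module k B]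
  [AddCommGroup V] [Module k V] [AddCommGroup M] [Module k M]

theorem tmul_induction₂ {motive : P ⊗[k] B → P ⊗[k] B → Prop}
    (zero_left : ∀ y, motive 0 y) (zero_right : ∀ x, motive x 0)
    (add_left : ∀ x x' y, motive x y → motive x' y → motive (x + x') y)
    (add_right : ∀ x y y', motive x y → motive x y' → motive x (y + y'))
    (tmul : ∀ p b q c, motive (p ⊗ₜ b) (q ⊗ₜ c)) (x y : P ⊗[k] B) : motive x y := by
  induction x with
  | zero => exact zero_left y
  | add x x' hx hx' => exact add_left x x' y hx hx'
  | tmul p b =>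
    induction y with
    | zero => exact zero_right _
    | add y y' hy hy' => exact add_right _ y y' hy hy'
    | tmul q c => exact tmul p b q c

/-- Bilinear maps `l₁`, `r₁`, `l₂`, `r₂` that behave on pure tensors like the left and right
multiplications of `P ⊗ B`, with product `f ⊗ m`, on the first and on the second leg of a
completed tensor product. Here `β X Y` stands for `X • Y`, `N` for the coproduct dual to `m`, and
`σ` for the twist of `B ⊗̂ B`, whose elements form `M`. -/
structure ActsOnTensors (β : P ⊗[k] P →ₗ[k] M →ₗ[k] V) (N : B →ₗ[k] M) (σ : M →ₗ[k] M)
    (m : B →ₗ[k] B →ₗ[k] B) (f : P →ₗ[k] P →ₗ[k] P)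
    (l₁ r₁ l₂ r₂ : P ⊗[k] B →ₗ[k] V →ₗ[k] V) : Prop where
  left_first : ∀ p b X c, l₁ (p ⊗ₜ b) (β X (N c)) = β ((f p).rTensor P X) (N (m b c))
  right_first : ∀ p b X c, r₁ (p ⊗ₜ b) (β X (N c)) = 0
  left_second : ∀ p b X c, l₂ (p ⊗ₜ b) (β X (N c)) = β ((f p).lTensor P X) (N (m b c))
  right_second : ∀ p b X c, r₂ (p ⊗ₜ b) (β X (N c)) = β ((f.flip p).lTensor P X) (N (m c b))
  left_first_flip : ∀ p b X c,
    l₁ (p ⊗ₜ b) (β X (σ (N c))) = β ((f p).rTensor P X) (σ (N (m b c)))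
  right_first_flip : ∀ p b X c,
    r₁ (p ⊗ₜ b) (β X (σ (N c))) = β ((f.flip p).rTensor P X) (σ (N (m c b)))
  left_second_flip : ∀ p b X c,
    l₂ (p ⊗ₜ b) (β X (σ (N c))) = β ((f p).lTensor P X) (σ (N (m b c)))
  right_second_flip : ∀ p b X c, r₂ (p ⊗ₜ b) (β X (σ (N c))) = 0

/-- The operations of the induced bialgebra `P ⊗ B`, reduced to their values on pure tensors: the
multiplications by the perm product (`l₁`, `r₁`, `l₂`, `r₂`) and by the Leibniz product (`L₁`, `R₁`,
`L₂`, `R₂`) on either leg, the coproducts `ν` and `ϑ`, and the twists `τ` and `σ`. The conditions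
of a DPP bialgebra that involve both products and coproducts follow from these data by linear
algebra, in an arbitrary module `V` in place of the completed tensor product. -/
structure CompatibilityData (mulP brP : P →ₗ[k] P →ₗ[k] P) (Δ δ : P →ₗ[k] P ⊗[k] P)
    (m : B →ₗ[k] B →ₗ[k] B) (β : P ⊗[k] P →ₗ[k] M →ₗ[k] V) (N : B →ₗ[k] M) (σ : M →ₗ[k] M)
    (τ : V →ₗ[k] V) (ν ϑ : P ⊗[k] B →ₗ[k] V)
    (l₁ r₁ l₂ r₂ L₁ R₁ L₂ R₂ : P ⊗[k] B →ₗ[k] V →ₗ[k] V) : Prop where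
  mul : ActsOnTensors β N σ m mulP l₁ r₁ l₂ r₂
  br : ActsOnTensors β N σ m brP L₁ R₁ L₂ R₂
  flip_commutator : ∀ b c, σ (N (m b c) - N (m c b)) = N (m b c) - N (m c b)
  twist : ∀ X Y, τ (β X Y) = β (TensorProduct.comm k P P X) (σ Y)
  coproduct : ∀ p b, ν (p ⊗ₜ b) = β (Δ p) (N b)
  cobracket : ∀ p b, ϑ (p ⊗ₜ b) = β (δ p) (N b)

theorem IsPoissonAlgebra.mul_flip {mulP brP : P →ₗ[k] P →ₗ[k] P}
    (h : IsPoissonAlgebra mulP brP) : mulP.flip = mulP := by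
  ext p q
  exact h.comm q p

theorem IsPoissonAlgebra.br_flip {mulP brP : P →ₗ[k] P →ₗ[k] P}
    (h : IsPoissonAlgebra mulP brP) : brP.flip = -brP := by
  ext p q
  exact h.antisymm q p

/-- The infinitesimal condition with its two arguments exchanged. -/
theorem IsPoissonBialgebra.infinitesimal' {mulP brP : P →ₗ[k] P →ₗ[k] P} {Δ δ : P →ₗ[k] P ⊗[k] P}
    (hP : IsPoissonBialgebra mulP brP Δ δ) (p q : P) :
    Δ (mulP p q) = (mulP p).rTensor P (Δ q) + (mulP q).lTensor P (Δ p) := by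
  rw [hP.alg.comm, hP.infinitesimal]

/-- The relation `Δ[p, q] + Δ[q, p] = 0`, written out and solved for one of its terms. -/
theorem IsPoissonBialgebra.lTensor_mul_cobracket {mulP brP : P →ₗ[k] P →ₗ[k] P}
    {Δ δ : P →ₗ[k] P ⊗[k] P} (hP : IsPoissonBialgebra mulP brP Δ δ) (p q : P) :
    (mulP q).lTensor P (δ p) = (brP p).rTensor P (Δ q) + (brP p).lTensor P (Δ q)
      + (mulP q).rTensor P (δ p) + (brP q).rTensor P (Δ p) + (brP q).lTensor P (Δ p)
      + (mulP p).rTensor P (δ q) - (mulP p).lTensor P (δ q) := by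
  have h : Δ (brP p q) + Δ (brP q p) = 0 := by
    rw [hP.alg.antisymm p q, map_neg, neg_add_cancel]
  rw [hP.compat₁, hP.compat₁] at h
  rw [← sub_eq_zero, ← neg_eq_zero, ← h]
  abel

variable {mulP brP : P →ₗ[k] P →ₗ[k] P} {Δ δ : P →ₗ[k] P ⊗[k] P}
    {m : B →ₗ[k] B →ₗ[k] B} {β : P ⊗[k] P →ₗ[k] M →ₗ[k] V} {N : B →ₗ[k] M} {σ : M →ₗ[k] M}
    {τ : V →ₗ[k] V} {ν ϑ : P ⊗[k] B →ₗ[k] V}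
    {l₁ r₁ l₂ r₂ L₁ R₁ L₂ R₂ : P ⊗[k] B →ₗ[k] V →ₗ[k] V}

variable (hP : IsPoissonBialgebra mulP brP Δ δ)
  (H : CompatibilityData mulP brP Δ δ m β N σ τ ν ϑ l₁ r₁ l₂ r₂ L₁ R₁ L₂ R₂)
include hP H

/-- The coproduct on pure tensors, and its twist. -/
theorem CompatibilityData.coproduct_rules :
    (∀ p b, ν (p ⊗ₜ b) = β (Δ p) (N b)) ∧ (∀ p b, ϑ (p ⊗ₜ b) = β (δ p) (N b)) ∧
    (∀ p b, τ (β (Δ p) (N b)) = β (Δ p) (σ (N b))) ∧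
    (∀ p b, τ (β (δ p) (N b)) = -β (δ p) (σ (N b))) := by
  refine ⟨H.coproduct, H.cobracket, fun p b => ?_, fun p b => ?_⟩
  · rw [H.twist, hP.coalg.cocomm]
  · rw [H.twist, hP.coalg.coantisymm, map_neg, LinearMap.neg_apply]

/-- The actions on pure tensors; right multiplications of `P` are expressed by left ones. -/
theorem CompatibilityData.action_rules :
    (∀ p b X c, l₁ (p ⊗ₜ b) (β X (N c)) = β ((mulP p).rTensor P X) (N (m b c))) ∧
    (∀ p b X c, r₁ (p ⊗ₜ b) (β X (N c)) = 0) ∧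
    (∀ p b X c, l₂ (p ⊗ₜ b) (β X (N c)) = β ((mulP p).lTensor P X) (N (m b c))) ∧
    (∀ p b X c, r₂ (p ⊗ₜ b) (β X (N c)) = β ((mulP p).lTensor P X) (N (m c b))) ∧
    (∀ p b X c, l₁ (p ⊗ₜ b) (β X (σ (N c))) = β ((mulP p).rTensor P X) (σ (N (m b c)))) ∧
    (∀ p b X c, r₁ (p ⊗ₜ b) (β X (σ (N c))) = β ((mulP p).rTensor P X) (σ (N (m c b)))) ∧
    (∀ p b X c, l₂ (p ⊗ₜ b) (β X (σ (N c))) = β ((mulP p).lTensor P X) (σ (N (m b c)))) ∧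
    (∀ p b X c, r₂ (p ⊗ₜ b) (β X (σ (N c))) = 0) ∧
    (∀ p b X c, L₁ (p ⊗ₜ b) (β X (N c)) = β ((brP p).rTensor P X) (N (m b c))) ∧
    (∀ p b X c, R₁ (p ⊗ₜ b) (β X (N c)) = 0) ∧
    (∀ p b X c, L₂ (p ⊗ₜ b) (β X (N c)) = β ((brP p).lTensor P X) (N (m b c))) ∧
    (∀ p b X c, R₂ (p ⊗ₜ b) (β X (N c)) = -β ((brP p).lTensor P X) (N (m c b))) ∧
    (∀ p b X c, L₁ (p ⊗ₜ b) (β X (σ (N c))) = β ((brP p).rTensor P X) (σ (N (m b c)))) ∧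
    (∀ p b X c, R₁ (p ⊗ₜ b) (β X (σ (N c))) = -β ((brP p).rTensor P X) (σ (N (m c b)))) ∧
    (∀ p b X c, L₂ (p ⊗ₜ b) (β X (σ (N c))) = β ((brP p).lTensor P X) (σ (N (m b c)))) ∧
    (∀ p b X c, R₂ (p ⊗ₜ b) (β X (σ (N c))) = 0) := by
  refine ⟨H.mul.left_first, H.mul.right_first, H.mul.left_second, fun p b X c => ?_,
    H.mul.left_first_flip, fun p b X c => ?_, H.mul.left_second_flip, H.mul.right_second_flip,
    H.br.left_first, H.br.right_first, H.br.left_second, fun p b X c => ?_,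
    H.br.left_first_flip, fun p b X c => ?_, H.br.left_second_flip, H.br.right_second_flip⟩
  · rw [H.mul.right_second, hP.alg.mul_flip]
  · rw [H.mul.right_first_flip, hP.alg.mul_flip]
  · rw [H.br.right_second, hP.alg.br_flip, LinearMap.neg_apply, LinearMap.lTensor_neg,
      LinearMap.neg_apply, map_neg, LinearMap.neg_apply]
  · rw [H.br.right_first_flip, hP.alg.br_flip, LinearMap.neg_apply, LinearMap.rTensor_neg,
      LinearMap.neg_apply, map_neg, LinearMap.neg_apply]

omit hP in
/-- One of the four elements `N(bc)`, `N(cb)`, `σ N(bc)`, `σ N(cb)` is redundant. -/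
theorem CompatibilityData.flip_swap (b c : B) :
    σ (N (m c b)) = N (m c b) + σ (N (m b c)) - N (m b c) := by
  have h := H.flip_commutator b c
  rw [map_sub, sub_eq_iff_eq_add] at h
  rw [h]
  abel

theorem CompatibilityData.perm₁ (a b : P ⊗[k] B) :
    r₁ a (ν b) = τ (r₁ b (ν a)) := by
  rw [← sub_eq_zero]
  induction a, b using tmul_induction₂ with
  | zero_left b => simp
  | zero_right a => simp
  | add_left x x' y h h' =>
    refine Eq.trans ?_ ((congrArg₂ (· + ·) h h').trans (add_zero 0))
    simp only [map_add, map_sub, LinearMap.add_apply]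
    abel
  | add_right x y y' h h' =>
    refine Eq.trans ?_ ((congrArg₂ (· + ·) h h').trans (add_zero 0))
    simp only [map_add, map_sub, LinearMap.add_apply]
    abel
  | tmul p b q c =>
    simp only [tensorMul_tmul, TensorProduct.map_tmul, map_add, map_sub, map_neg, map_zero,
      H.coproduct_rules hP, H.action_rules hP]
    abel

theorem CompatibilityData.perm₂ (a b : P ⊗[k] B) :
    ν (tensorMul mulP m a b) = (l₁ a (ν b) - r₁ a (ν b)) + r₂ b (ν a) := by
  rw [← sub_eq_zero]
  induction a, b using tmul_induction₂ with
  | zero_left b => simp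
  | zero_right a => simp
  | add_left x x' y h h' =>
    refine Eq.trans ?_ ((congrArg₂ (· + ·) h h').trans (add_zero 0))
    simp only [map_add, map_sub, LinearMap.add_apply]
    abel
  | add_right x y y' h h' =>
    refine Eq.trans ?_ ((congrArg₂ (· + ·) h h').trans (add_zero 0))
    simp only [map_add, map_sub, LinearMap.add_apply]
    abel
  | tmul p b q c =>
    simp only [tensorMul_tmul, TensorProduct.map_tmul, map_add, map_sub, map_neg, map_zero,
      H.coproduct_rules hP, H.action_rules hP]
    simp only [hP.infinitesimal', map_add, map_sub,
      LinearMap.add_apply, LinearMap.sub_apply]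
    abel

theorem CompatibilityData.perm₃ (a b : P ⊗[k] B) :
    ν (tensorMul mulP m a b) = l₂ a (ν b) + (l₁ b (ν a - τ (ν a)) - r₁ b (ν a - τ (ν a))) := by
  rw [← sub_eq_zero]
  induction a, b using tmul_induction₂ with
  | zero_left b => simp
  | zero_right a => simp
  | add_left x x' y h h' =>
    refine Eq.trans ?_ ((congrArg₂ (· + ·) h h').trans (add_zero 0))
    simp only [map_add, map_sub, LinearMap.add_apply]
    abel
  | add_right x y y' h h' =>
    refine Eq.trans ?_ ((congrArg₂ (· + ·) h h').trans (add_zero 0))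
    simp only [map_add, map_sub, LinearMap.add_apply]
    abel
  | tmul p b q c =>
    simp only [tensorMul_tmul, TensorProduct.map_tmul, map_add, map_sub, map_neg, map_zero,
      H.coproduct_rules hP, H.action_rules hP]
    simp only [H.flip_swap b c, hP.infinitesimal, map_add, map_sub,
      LinearMap.add_apply, LinearMap.sub_apply]
    abel

theorem CompatibilityData.leibniz₁ (a b : P ⊗[k] B) :
    τ (R₁ b (ϑ a)) = R₁ a (ϑ b) := by
  rw [← sub_eq_zero]
  induction a, b using tmul_induction₂ with
  | zero_left b => simp
  | zero_right a => simp
  | add_left x x' y h h' =>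
    refine Eq.trans ?_ ((congrArg₂ (· + ·) h h').trans (add_zero 0))
    simp only [map_add, map_sub, LinearMap.add_apply]
    abel
  | add_right x y y' h h' =>
    refine Eq.trans ?_ ((congrArg₂ (· + ·) h h').trans (add_zero 0))
    simp only [map_add, map_sub, LinearMap.add_apply]
    abel
  | tmul p b q c =>
    simp only [tensorMul_tmul, TensorProduct.map_tmul, map_add, map_sub, map_neg, map_zero,
      H.coproduct_rules hP, H.action_rules hP]
    abel

theorem CompatibilityData.leibniz₂ (a b : P ⊗[k] B) :
    ϑ (tensorMul brP m a b) =
    (R₂ b (ϑ a + τ (ϑ a)) - (L₁ b (ϑ a + τ (ϑ a)) + R₁ b (ϑ a + τ (ϑ a)))) + (L₂ a (ϑ b) + L₁ a (ϑ b)) := by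
  rw [← sub_eq_zero]
  induction a, b using tmul_induction₂ with
  | zero_left b => simp
  | zero_right a => simp
  | add_left x x' y h h' =>
    refine Eq.trans ?_ ((congrArg₂ (· + ·) h h').trans (add_zero 0))
    simp only [map_add, map_sub, LinearMap.add_apply]
    abel
  | add_right x y y' h h' =>
    refine Eq.trans ?_ ((congrArg₂ (· + ·) h h').trans (add_zero 0))
    simp only [map_add, map_sub, LinearMap.add_apply]
    abel
  | tmul p b q c =>
    simp only [tensorMul_tmul, TensorProduct.map_tmul, map_add, map_sub, map_neg, map_zero,
      H.coproduct_rules hP, H.action_rules hP]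
    simp only [H.flip_swap b c, hP.lie, map_add, map_sub,
      LinearMap.add_apply, LinearMap.sub_apply]
    abel

theorem CompatibilityData.compat₁ (a b : P ⊗[k] B) :
    ν (tensorMul brP m a b) =
    (L₂ a (ν b) + L₁ a (ν b)) + ((l₁ b (ϑ a + τ (ϑ a)) - r₁ b (ϑ a + τ (ϑ a))) - r₂ b (ϑ a + τ (ϑ a))) := by
  rw [← sub_eq_zero]
  induction a, b using tmul_induction₂ with
  | zero_left b => simp
  | zero_right a => simp
  | add_left x x' y h h' =>
    refine Eq.trans ?_ ((congrArg₂ (· + ·) h h').trans (add_zero 0))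
    simp only [map_add, map_sub, LinearMap.add_apply]
    abel
  | add_right x y y' h h' =>
    refine Eq.trans ?_ ((congrArg₂ (· + ·) h h').trans (add_zero 0))
    simp only [map_add, map_sub, LinearMap.add_apply]
    abel
  | tmul p b q c =>
    simp only [tensorMul_tmul, TensorProduct.map_tmul, map_add, map_sub, map_neg, map_zero,
      H.coproduct_rules hP, H.action_rules hP]
    simp only [H.flip_swap b c, hP.compat₁, map_add, map_sub,
      LinearMap.add_apply, LinearMap.sub_apply]
    abel

theorem CompatibilityData.compat₂ (a b : P ⊗[k] B) :
    ϑ (tensorMul mulP m a b) = l₂ a (ϑ b) + r₂ b (ϑ a)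
    - (L₁ a (ν b) + R₁ a (ν b)) - (L₁ b (ν a - τ (ν a)) + R₁ b (ν a - τ (ν a))) := by
  rw [← sub_eq_zero]
  induction a, b using tmul_induction₂ with
  | zero_left b => simp
  | zero_right a => simp
  | add_left x x' y h h' =>
    refine Eq.trans ?_ ((congrArg₂ (· + ·) h h').trans (add_zero 0))
    simp only [map_add, map_sub, LinearMap.add_apply]
    abel
  | add_right x y y' h h' =>
    refine Eq.trans ?_ ((congrArg₂ (· + ·) h h').trans (add_zero 0))
    simp only [map_add, map_sub, LinearMap.add_apply]
    abel
  | tmul p b q c =>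
    simp only [tensorMul_tmul, TensorProduct.map_tmul, map_add, map_sub, map_neg, map_zero,
      H.coproduct_rules hP, H.action_rules hP]
    simp only [H.flip_swap b c, hP.compat₂, hP.lTensor_mul_cobracket p q, map_add, map_sub,
      LinearMap.add_apply, LinearMap.sub_apply]
    abel

theorem CompatibilityData.compat₃ (a b : P ⊗[k] B) :
    R₂ a (τ (ν b)) = -r₁ b (ϑ a) := by
  rw [← sub_eq_zero]
  induction a, b using tmul_induction₂ with
  | zero_left b => simp
  | zero_right a => simp
  | add_left x x' y h h' =>
    refine Eq.trans ?_ ((congrArg₂ (· + ·) h h').trans (add_zero 0))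
    simp only [map_add, map_sub, LinearMap.add_apply]
    abel
  | add_right x y y' h h' =>
    refine Eq.trans ?_ ((congrArg₂ (· + ·) h h').trans (add_zero 0))
    simp only [map_add, map_sub, LinearMap.add_apply]
    abel
  | tmul p b q c =>
    simp only [tensorMul_tmul, TensorProduct.map_tmul, map_add, map_sub, map_neg, map_zero,
      H.coproduct_rules hP, H.action_rules hP]
    abel

theorem CompatibilityData.compat₄ (a b : P ⊗[k] B) :
    ν (tensorMul brP m a b) =
    (l₂ a (ϑ b) - l₁ a (ϑ b)) + (R₂ b (ν a - τ (ν a)) - (L₁ b (ν a - τ (ν a)) + R₁ b (ν a - τ (ν a)))) := by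
  rw [← sub_eq_zero]
  induction a, b using tmul_induction₂ with
  | zero_left b => simp
  | zero_right a => simp
  | add_left x x' y h h' =>
    refine Eq.trans ?_ ((congrArg₂ (· + ·) h h').trans (add_zero 0))
    simp only [map_add, map_sub, LinearMap.add_apply]
    abel
  | add_right x y y' h h' =>
    refine Eq.trans ?_ ((congrArg₂ (· + ·) h h').trans (add_zero 0))
    simp only [map_add, map_sub, LinearMap.add_apply]
    abel
  | tmul p b q c =>
    simp only [tensorMul_tmul, TensorProduct.map_tmul, map_add, map_sub, map_neg, map_zero,
      H.coproduct_rules hP, H.action_rules hP]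
    simp only [H.flip_swap b c, hP.compat₁, hP.lTensor_mul_cobracket p q, map_add, map_sub,
      LinearMap.add_apply, LinearMap.sub_apply]
    abel

theorem CompatibilityData.compat₅ (a b : P ⊗[k] B) :
    ϑ (tensorMul mulP m a b) + τ (ϑ (tensorMul mulP m a b)) =
    l₂ a (ϑ b + τ (ϑ b)) + l₂ b (ϑ a + τ (ϑ a)) - L₁ a (ν b - τ (ν b)) - L₁ b (ν a - τ (ν a)) := by
  rw [← sub_eq_zero]
  induction a, b using tmul_induction₂ with
  | zero_left b => simp
  | zero_right a => simp
  | add_left x x' y h h' =>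
    refine Eq.trans ?_ ((congrArg₂ (· + ·) h h').trans (add_zero 0))
    simp only [map_add, map_sub, LinearMap.add_apply]
    abel
  | add_right x y y' h h' =>
    refine Eq.trans ?_ ((congrArg₂ (· + ·) h h').trans (add_zero 0))
    simp only [map_add, map_sub, LinearMap.add_apply]
    abel
  | tmul p b q c =>
    simp only [tensorMul_tmul, TensorProduct.map_tmul, map_add, map_sub, map_neg, map_zero,
      H.coproduct_rules hP, H.action_rules hP]
    simp only [H.flip_swap b c, hP.compat₂, hP.lTensor_mul_cobracket p q, map_add, map_sub,
      LinearMap.add_apply, LinearMap.sub_apply]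
    abel

theorem CompatibilityData.compat₆ (a b : P ⊗[k] B) :
    ϑ (tensorMul mulP m a b) =
    l₁ a (ϑ b) - R₂ b (ν a - τ (ν a)) + L₂ a (ν b) + (l₁ b (ϑ a + τ (ϑ a)) - r₁ b (ϑ a + τ (ϑ a))) := by
  rw [← sub_eq_zero]
  induction a, b using tmul_induction₂ with
  | zero_left b => simp
  | zero_right a => simp
  | add_left x x' y h h' =>
    refine Eq.trans ?_ ((congrArg₂ (· + ·) h h').trans (add_zero 0))
    simp only [map_add, map_sub, LinearMap.add_apply]
    abel
  | add_right x y y' h h' =>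
    refine Eq.trans ?_ ((congrArg₂ (· + ·) h h').trans (add_zero 0))
    simp only [map_add, map_sub, LinearMap.add_apply]
    abel
  | tmul p b q c =>
    simp only [tensorMul_tmul, TensorProduct.map_tmul, map_add, map_sub, map_neg, map_zero,
      H.coproduct_rules hP, H.action_rules hP]
    simp only [H.flip_swap b c, hP.compat₂, map_add, map_sub,
      LinearMap.add_apply, LinearMap.sub_apply]
    abel

theorem CompatibilityData.compat₇ (a b : P ⊗[k] B) :
    ν (tensorMul brP m a b + tensorMul brP m b a) =
    (L₂ a (ν b) + R₂ a (ν b)) + (L₁ a (τ (ν b)) + R₁ a (τ (ν b)))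
    + (l₂ b (ϑ a) - r₂ b (ϑ a)) + (l₁ b (τ (ϑ a)) - r₁ b (τ (ϑ a))) := by
  rw [← sub_eq_zero]
  induction a, b using tmul_induction₂ with
  | zero_left b => simp
  | zero_right a => simp
  | add_left x x' y h h' =>
    refine Eq.trans ?_ ((congrArg₂ (· + ·) h h').trans (add_zero 0))
    simp only [map_add, map_sub, LinearMap.add_apply]
    abel
  | add_right x y y' h h' =>
    refine Eq.trans ?_ ((congrArg₂ (· + ·) h h').trans (add_zero 0))
    simp only [map_add, map_sub, LinearMap.add_apply]
    abel
  | tmul p b q c =>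
    simp only [tensorMul_tmul, TensorProduct.map_tmul, map_add, map_sub, map_neg, map_zero,
      H.coproduct_rules hP, H.action_rules hP]
    simp only [H.flip_swap b c, hP.compat₁, hP.lTensor_mul_cobracket p q, map_add, map_sub,
      LinearMap.add_apply, LinearMap.sub_apply]
    abel

end Compatibility

/-! ### The induced completed DPP bialgebra -/

section Bialgebra

variable {k P B : Type*} [Field k] [AddCommGroup P] [Module k P] [AddCommGroup B] [Module k B]
  {ℬ : ℤ → Submodule k B} [DirectSum.Decomposition ℬ] {m : B →ₗ[k] B →ₗ[k] B}
  {ω : B →ₗ[k] B →ₗ[k] k} {N : B →ₗ[k] CTensor ℬ}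

theorem rowFinite_tensorMul (f : P →ₗ[k] P →ₗ[k] P) (hm : IsGradedMul ℬ m) (a : P ⊗[k] B) :
    tensorMul f m a ∈ rowFinite (tensorGrading P ℬ) :=
  mem_rowFinite_left (isGradedMul_tensorMul f hm) a

theorem rowFinite_tensorMul_flip (f : P →ₗ[k] P →ₗ[k] P) (hm : IsGradedMul ℬ m) (a : P ⊗[k] B) :
    (tensorMul f m).flip a ∈ rowFinite (tensorGrading P ℬ) :=
  mem_rowFinite_right (isGradedMul_tensorMul f hm) a

theorem IsFormCoproduct.actsOnTensors (hN : IsFormCoproduct ℬ m ω N)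
    (hB : IsQuadraticGradedPermAlgebra ℬ m ω) (f : P →ₗ[k] P →ₗ[k] P) :
    ActsOnTensors (bulletₗ ℬ) N (flipₗ ℬ) m f
      (actFirst (tensorMul f m) (rowFinite_tensorMul f hB.perm.graded))
      (actFirst (tensorMul f m).flip (rowFinite_tensorMul_flip f hB.perm.graded))
      (actSecond (tensorMul f m) (rowFinite_tensorMul f hB.perm.graded))
      (actSecond (tensorMul f m).flip (rowFinite_tensorMul_flip f hB.perm.graded)) := by
  have hl := fun b => mem_rowFinite_left hB.perm.graded b
  have hr := fun b => mem_rowFinite_right hB.perm.graded b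
  constructor <;> intro p b X c
  · rw [actFirst_apply, tensorMul_tmul, cMap_map_first _ (hl b), hN.cMap_left_first hB]
  · rw [actFirst_apply, tensorMul_flip_tmul, cMap_map_first _ (hr b), hN.cMap_right_first hB,
      map_zero]
  · rw [actSecond_apply, tensorMul_tmul, cMap_map_second _ (hl b), hN.cMap_left_second hB]
  · rw [actSecond_apply, tensorMul_flip_tmul, cMap_map_second _ (hr b), hN.cMap_right_second hB]
  · rw [actFirst_apply, tensorMul_tmul, cMap_map_first _ (hl b), flipₗ_apply, ← flip_cMap,
      hN.cMap_left_second hB, flipₗ_apply]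
  · rw [actFirst_apply, tensorMul_flip_tmul, cMap_map_first _ (hr b), flipₗ_apply, ← flip_cMap,
      hN.cMap_right_second hB, flipₗ_apply]
  · rw [actSecond_apply, tensorMul_tmul, cMap_map_second _ (hl b), flipₗ_apply, ← flip_cMap,
      hN.cMap_left_first hB, flipₗ_apply]
  · rw [actSecond_apply, tensorMul_flip_tmul, cMap_map_second _ (hr b), flipₗ_apply, ← flip_cMap,
      hN.cMap_right_first hB, ← flipₗ_apply, map_zero, map_zero]

variable {mulP brP : P →ₗ[k] P →ₗ[k] P} {Δ δ : P →ₗ[k] P ⊗[k] P}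

theorem IsFormCoproduct.compatibilityData (hN : IsFormCoproduct ℬ m ω N)
    (hB : IsQuadraticGradedPermAlgebra ℬ m ω) :
    CompatibilityData mulP brP Δ δ m (bulletₗ ℬ) N (flipₗ ℬ) (flipₗ (tensorGrading P ℬ))
      (bullet ℬ Δ N) (bullet ℬ δ N)
      (actFirst (tensorMul mulP m) (rowFinite_tensorMul mulP hB.perm.graded))
      (actFirst (tensorMul mulP m).flip (rowFinite_tensorMul_flip mulP hB.perm.graded))
      (actSecond (tensorMul mulP m) (rowFinite_tensorMul mulP hB.perm.graded))
      (actSecond (tensorMul mulP m).flip (rowFinite_tensorMul_flip mulP hB.perm.graded))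
      (actFirst (tensorMul brP m) (rowFinite_tensorMul brP hB.perm.graded))
      (actFirst (tensorMul brP m).flip (rowFinite_tensorMul_flip brP hB.perm.graded))
      (actSecond (tensorMul brP m) (rowFinite_tensorMul brP hB.perm.graded))
      (actSecond (tensorMul brP m).flip (rowFinite_tensorMul_flip brP hB.perm.graded)) where
  mul := hN.actsOnTensors hB mulP
  br := hN.actsOnTensors hB brP
  flip_commutator := hN.flip_commutator hB
  twist X Y := flip_bulletₗ X Y
  coproduct _ _ := rfl
  cobracket _ _ := rfl

omit [DirectSum.Decomposition ℬ] in
theorem finite_tensorGrading [Module.Finite k P] (hfin : ∀ i, Module.Finite k (ℬ i)) (i : ℤ) :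
    Module.Finite k (tensorGrading P ℬ i) :=
  have := hfin i
  Module.Finite.of_surjective _ (toTensorGrading_surjective P ℬ i)

theorem isCompletedDPPBialgebra_bullet [Module.Finite k P]
    (hP : IsPoissonBialgebra mulP brP Δ δ) (hB : IsQuadraticGradedPermAlgebra ℬ m ω)
    (hN : IsFormCoproduct ℬ m ω N) :
    IsCompletedDPPBialgebra (tensorGrading P ℬ) (tensorMul mulP m) (tensorMul brP m)
      (bullet ℬ Δ N) (bullet ℬ δ N) := by
  have H := hN.compatibilityData hB (mulP := mulP) (brP := brP) (Δ := Δ) (δ := δ)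
  have hfin := finite_tensorGrading (P := P) hB.perm.finite
  have hm := isGradedMul_tensorMul mulP hB.perm.graded
  have hs := isGradedMul_tensorMul brP hB.perm.graded
  have hsub₁ := fun a => cMap_sub_left (mem_rowFinite_left hm a) (mem_rowFinite_right hm a)
  have hsub₂ := fun a => cMap_sub_right (mem_rowFinite_left hm a) (mem_rowFinite_right hm a)
  have hadd₁ := fun a => cMap_add_left (mem_rowFinite_left hs a) (mem_rowFinite_right hs a)
  have hadd₂ := fun a => cMap_add_right (mem_rowFinite_left hs a) (mem_rowFinite_right hs a)
  refine
    { alg := ⟨isDPPAlgebra_tensorMul hP.alg hB.perm.perm, hfin, hm, hs⟩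
      coalg := isCompletedDPPCoalgebra_bullet hN hB hP.coalg
      perm :=
        { alg := ⟨isPermAlgebra_tensorMul hP.alg hB.perm.perm, hfin, hm⟩
          coalg := isCompletedPermCoalgebra_bullet hN hB hP.coalg
          compat₁ := H.perm₁ hP
          compat₂ := fun a b => ?_
          compat₃ := fun a b => ?_ }
      leibniz :=
        { alg := ⟨isLeibnizAlgebra_tensorMul hP.alg hB.perm.perm, hfin, hs⟩
          coalg := isCompletedLeibnizCoalgebra_bullet hN hB hP.coalg
          compat₁ := H.leibniz₁ hP
          compat₂ := fun a b => ?_ }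
      compat₁ := fun a b => ?_
      compat₂ := fun a b => ?_
      compat₃ := H.compat₃ hP
      compat₄ := fun a b => ?_
      compat₅ := H.compat₅ hP
      compat₆ := fun a b => ?_
      compat₇ := fun a b => ?_ }
  · rw [hsub₁]
    exact H.perm₂ hP a b
  · rw [hsub₁]
    exact H.perm₃ hP a b
  · rw [hadd₁]
    exact H.leibniz₂ hP a b
  · rw [hsub₁]
    exact H.compat₁ hP a b
  · rw [hadd₁, hadd₁]
    exact H.compat₂ hP a b
  · rw [hadd₁]
    exact H.compat₄ hP a b
  · rw [hsub₁]
    exact H.compat₆ hP a b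
  · rw [hsub₁, hsub₂, hadd₁, hadd₂]
    exact H.compat₇ hP a b

end Bialgebra

end

end CompletedDPP

theorem mainTheorem2 {k P B : Type*} [Field k] [CharZero k]
    [AddCommGroup P] [Module k P] [Module.Finite k P] [AddCommGroup B] [Module k B]
    (mulP brP : P →ₗ[k] P →ₗ[k] P) (Δ δ : P →ₗ[k] P ⊗[k] P)
    (hP : CompletedDPP.IsPoissonBialgebra mulP brP Δ δ)
    (ℬ : ℤ → Submodule k B) [DirectSum.Decomposition ℬ]
    (mulB : B →ₗ[k] B →ₗ[k] B) (ω : B →ₗ[k] B →ₗ[k] k)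
    (hB : CompletedDPP.IsQuadraticGradedPermAlgebra ℬ mulB ω) :
    ∃ νω : B →ₗ[k] CompletedDPP.CTensor ℬ,
      CompletedDPP.IsFormCoproduct ℬ mulB ω νω ∧
      (∀ ν' : B →ₗ[k] CompletedDPP.CTensor ℬ,
        CompletedDPP.IsFormCoproduct ℬ mulB ω ν' → ν' = νω) ∧
      CompletedDPP.IsCompletedDPPBialgebra (CompletedDPP.tensorGrading P ℬ)
        (CompletedDPP.tensorMul mulP mulB) (CompletedDPP.tensorMul brP mulB)
        (CompletedDPP.bullet ℬ Δ νω) (CompletedDPP.bullet ℬ δ νω) := by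
  have := hB.perm.finite
  obtain ⟨d, hω⟩ := hB.exists_symplectic
  have hN := CompletedDPP.isFormCoproduct_formCoproduct (m := mulB) hω
  exact ⟨_, hN, fun ν' hν' => hν'.unique hω hN,
    CompletedDPP.isCompletedDPPBialgebra_bullet hP hB hN⟩
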